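/- **Definitions.** A *graph* is a finite CW complex of dimension at most $1$ (loops and multiple edges allowed), given combinatorially by a finite set $V$ of vertices and a finite set $D$ of oriented edges with a fixed-point-free involution $\mathrm{rev}$ (reversal) and an initial-vertex map $D\to V$; an edge is a pair $\{d,\mathrm{rev}(d)\}$. A graph *of genus $g$* is a non-empty connected graph with $\#\text{edges}-\#\text{vertices}+1=g$. A *graph morphism* $G\to G'$ sends each vertex to a vertex and each edge either to a vertex (a contracted edge) or, with a specified orientation, to an edge, compatibly with endpoints; equivalently, it is a cellular map taking each vertex to a vertex and each edge to a vertex or an edge, up to homotopy through such maps. A *contraction* is a surjective graph morphism with contractible fibers: exactly one edge of $G$ is mapped to each edge of $G'$, and for each vertex $x$ of $G'$ the subgraph of vertices and edges mapped to $x$ is a tree (a graph of genus $0$). Let $\mathcal G_g$ be the category whose objects are graphs of genus $g$ and whose morphisms are contractions. For an object $x$ of a category $\mathcal C$, let $\mathcal C_x$ be the set of morphisms out of $x$, where $f\colon x\to y$ and $f'\colon x\to y'$ are identified if $f'=h\circ f$ for an isomorphism $h\colon y\to y'$; write $f\le f'$ if $f'=h\circ f$ for some morphism $h$. An essentially small category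 $\mathcal C$ is *Gröbner* if its only endomorphisms are identities and, for every object $x$: - (G1) $\mathcal C_x$ admits a well-order $\preceq$ such that, for all $f,f'\colon x\to y$ and $h\colon y\to z$, if $f\prec f'$ then $h\circ f\prec h\circ f'$; - (G2) for every infinite sequence $f_0,f_1,\dots$ in $\mathcal C_x$ there are $i<j$ with $f_i\le f_j$. A functor $\Phi\colon\mathcal C'\to\mathcal C$ has *property (F)* if for every object $x$ of $\mathcal C$ there are finitely many objects $y_1,\dots,y_r$ of $\mathcal C'$ and morphisms $f_i\colon x\to\Phi(y_i)$ such that every morphism $f\colon x\to\Phi(y)$, with $y$ in $\mathcal C'$, has the form $f=\Phi(e)\circ f_i$ for some $i$ and some $e\colon y_i\to y$. A category $\mathcal C$ is *quasi-Gröbner* if there are a Gröbner category $\mathcal C'$ and an essentially surjective functor $\mathcal C'\to\mathcal C$ with property (F). For a commutative ring $k$, let $\operatorname{Rep}_k(\mathcal C)$ be the category of functors from $\mathcal C$ to $k$-modules. An object $M$ is *finitely generated* if there are finitely many objects $x_1,\dots,x_r$ and elements $v_i\in M(x_i)$ such that, for every object $x$, the $k$-module $M(x)$ is spanned by the images of the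 $v_i$ under the maps induced by all morphisms $x_i\to x$. $\operatorname{Rep}_k(\mathcal C)$ is *locally Noetherian* if every subobject of a finitely generated object is finitely generated. **Theorem 1.1.** For every integer $g\ge 0$, the category $\mathcal G_g^{\mathrm{op}}$ is quasi-Gröbner, and, for every Noetherian commutative ring $k$, the category $\operatorname{Rep}_k(\mathcal G_g^{\mathrm{op}})$ is locally Noetherian. -/

import Mathlib

open CategoryTheory

universe u v u₁ v₁ w

namespace GraphContraction

/-! ### Graphs -/

/-- A graph: a finite CW complex of dimension at most one, presented by its cells.
`V` is the set of vertices (0-cells) and `D` the set of oriented edges: every edge (1-cell) occurs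
twice in `D`, once for each of its two orientations, and `rev` exchanges the two. `src d` is the
vertex at which `d` starts, so that `src (rev d)` is the vertex at which it ends.
Loops and multiple edges are allowed. -/
structure Graph where
  V : Type
  D : Type
  finV : Finite V
  finD : Finite D
  src : D → V
  rev : D → D
  rev_rev : ∀ d, rev (rev d) = d
  rev_ne : ∀ d, rev d ≠ d

attribute [instance] Graph.finV Graph.finD

namespace Graph

/-- Two oriented edges are equivalent if they are orientations of the same edge. -/
def edgeSetoid (G : Graph) : Setoid G.D where
  r a b := a = b ∨ a = G.rev b
  iseqv :=
    { refl := fun _ => Or.inl rfl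
      symm := by
        rintro a b (h | h)
        · exact Or.inl h.symm
        · exact Or.inr (by rw [h, G.rev_rev])
      trans := by
        rintro a b c (rfl | rfl) (rfl | rfl)
        · exact Or.inl rfl
        · exact Or.inr rfl
        · exact Or.inr rfl
        · exact Or.inl (G.rev_rev c) }

/-- The (unoriented) edges of a graph. -/
def Edge (G : Graph) : Type := Quotient G.edgeSetoid

/-- The number of vertices. -/
noncomputable def numVertices (G : Graph) : ℕ := Nat.card G.V

/-- The number of edges. -/
noncomputable def numEdges (G : Graph) : ℕ := Nat.card G.Edge

/-- `u` and `v` are the endpoints of an edge. -/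
def Adj (G : Graph) (u v : G.V) : Prop := ∃ d : G.D, G.src d = u ∧ G.src (G.rev d) = v

/-- A graph is connected if it is non-empty and any two vertices are joined by an edge path. -/
def Connected (G : Graph) : Prop :=
  Nonempty G.V ∧ ∀ u v : G.V, Relation.ReflTransGen G.Adj u v

/-- `G` is a graph of genus `g`: it is non-empty and connected, and its first Betti number
`#edges - #vertices + 1` is equal to `g`. -/
def HasGenus (G : Graph) (g : ℕ) : Prop :=
  G.Connected ∧ (G.numEdges : ℤ) - (G.numVertices : ℤ) + 1 = (g : ℤ)

/-- A finite graph is contractible if and only if it is a tree, that is, a graph of genus `0`. -/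
def IsContractible (G : Graph) : Prop := G.HasGenus 0

theorem card_D (G : Graph) : Nat.card G.D = 2 * G.numEdges := by
  classical
  let r : G.Edge → G.D := fun e => Quotient.out (s := G.edgeSetoid) e
  let q : G.D → G.Edge := fun d => Quotient.mk G.edgeSetoid d
  have hq : ∀ d, q (G.rev d) = q d := fun d => Quotient.sound (Or.inr rfl)
  have hqr : ∀ e, q (r e) = e := fun e => Quotient.out_eq (s := G.edgeSetoid) e
  have hrq : ∀ d, r (q d) = d ∨ r (q d) = G.rev d := fun d =>
    Quotient.mk_out (s := G.edgeSetoid) d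
  have hb : Function.Bijective
      (fun p : G.Edge × Bool => if p.2 then r p.1 else G.rev (r p.1)) := by
    constructor
    · rintro ⟨e, b⟩ ⟨e', b'⟩ h
      have he : e = e' := by
        have h2 := congrArg q h
        cases b <;> cases b' <;> simpa [hq, hqr] using h2
      subst he
      cases b <;> cases b'
      · rfl
      · exact absurd (by simpa using h) (G.rev_ne (r e))
      · exact absurd (by simpa using h.symm) (G.rev_ne (r e))
      · rfl
    · intro d
      rcases hrq d with h | h
      · exact ⟨(q d, true), by simpa using h⟩
      · exact ⟨(q d, false), by simp [h, G.rev_rev]⟩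
  rw [← Nat.card_congr (Equiv.ofBijective _ hb), Nat.card_prod, numEdges]
  simp [mul_comm]

/-! ### Graph morphisms -/

/-- A morphism of graphs: a map of CW complexes that takes vertices to vertices and each edge either
to a vertex (`Sum.inl`; such an edge is said to be contracted) or to an edge (`Sum.inr`), up to
homotopy through such maps. The homotopy class is recorded by the images of the vertices and of
the oriented edges; these are compatible with reversal and with initial vertices. -/
@[ext]
structure Hom (G G' : Graph) where
  onV : G.V → G'.V
  onD : G.D → G'.V ⊕ G'.D
  onD_rev : ∀ d, onD (G.rev d) = (onD d).map id G'.rev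
  onV_src : ∀ d, onV (G.src d) = (onD d).elim id G'.src

/-- The identity morphism. -/
def Hom.id (G : Graph) : Hom G G where
  onV := fun x => x
  onD := Sum.inr
  onD_rev := fun _ => rfl
  onV_src := fun _ => rfl

/-- Composition of morphisms. -/
def Hom.comp {G G' G'' : Graph} (φ : Hom G G') (ψ : Hom G' G'') : Hom G G'' where
  onV := fun x => ψ.onV (φ.onV x)
  onD := fun d => (φ.onD d).elim (fun x => Sum.inl (ψ.onV x)) ψ.onD
  onD_rev := by
    intro d
    rw [φ.onD_rev]
    rcases φ.onD d with x | d'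
    · rfl
    · exact ψ.onD_rev d'
  onV_src := by
    intro d
    rw [φ.onV_src]
    rcases φ.onD d with x | d'
    · rfl
    · exact ψ.onV_src d'

/-- The fiber of a morphism over a vertex `x`: the subgraph of `G` consisting of the vertices and
the edges that are mapped to `x`. -/
def Hom.fiber {G G' : Graph} (φ : Hom G G') (x : G'.V) : Graph where
  V := {a : G.V // φ.onV a = x}
  D := {d : G.D // φ.onD d = Sum.inl x}
  finV := inferInstance
  finD := inferInstance
  src := fun d => ⟨G.src d.1, by rw [φ.onV_src, d.2]; rfl⟩
  rev := fun d => ⟨G.rev d.1, by rw [φ.onD_rev, d.2]; rfl⟩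
  rev_rev := fun d => Subtype.ext (G.rev_rev d.1)
  rev_ne := fun d h => G.rev_ne d.1 (congrArg Subtype.val h)

/-- A contraction is a surjective morphism with contractible fibers. The fiber over an interior
point of an edge consists of one point for each edge that is mapped to that edge, so it is
contractible if and only if there is exactly one such edge; the fiber over a vertex is the graph
`φ.fiber x`. (Surjectivity holds because contractible spaces are non-empty.) -/
structure Hom.IsContraction {G G' : Graph} (φ : Hom G G') : Prop where
  edge : ∀ d' : G'.D, ∃! d : G.D, φ.onD d = Sum.inr d'
  vertex : ∀ x : G'.V, (φ.fiber x).IsContractible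

theorem isContractible_iff (G : Graph) :
    G.IsContractible ↔ G.Connected ∧ Nat.card G.D + 2 = 2 * Nat.card G.V := by
  unfold IsContractible HasGenus
  rw [card_D]
  unfold numVertices
  refine and_congr_right fun _ => ?_
  push_cast
  omega

theorem Hom.isContraction_id (G : Graph) : (Hom.id G).IsContraction where
  edge := fun d' => ⟨d', rfl, fun _ h => Sum.inr_injective h⟩
  vertex := by
    intro x
    rw [isContractible_iff]
    have hE : IsEmpty ((Hom.id G).fiber x).D := ⟨fun d => by
      have h : (Sum.inr d.1 : G.V ⊕ G.D) = Sum.inl x := d.2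
      cases h⟩
    have hS : ∀ a : ((Hom.id G).fiber x).V, a = ⟨x, rfl⟩ := fun a => Subtype.ext a.2
    have hU : Nat.card ((Hom.id G).fiber x).V = 1 :=
      Nat.card_eq_one_iff_exists.2 ⟨⟨x, rfl⟩, hS⟩
    refine ⟨⟨⟨⟨x, rfl⟩⟩, fun a b => ?_⟩, ?_⟩
    · rw [hS a, hS b]
      exact Relation.ReflTransGen.refl
    · rw [hU, Nat.card_of_isEmpty]

theorem Hom.isContraction_comp {G G' G'' : Graph} {φ : Hom G G'} {ψ : Hom G' G''}
    (hφ : φ.IsContraction) (hψ : ψ.IsContraction) : (φ.comp ψ).IsContraction where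
  edge := by
    intro d''
    obtain ⟨d', hd', hu'⟩ := hψ.edge d''
    obtain ⟨d, hd, hu⟩ := hφ.edge d'
    refine ⟨d, ?_, ?_⟩
    · change (φ.onD d).elim (fun x => Sum.inl (ψ.onV x)) ψ.onD = _
      rw [hd]
      exact hd'
    · intro c hc
      change (φ.onD c).elim (fun x => Sum.inl (ψ.onV x)) ψ.onD = _ at hc
      rcases hcc : φ.onD c with x | c'
      · rw [hcc] at hc
        cases hc
      · rw [hcc] at hc
        rw [hu' c' hc] at hcc
        exact hu c hcc
  vertex := by
    classical
    intro w
    obtain ⟨⟨⟨y₀⟩, hψc⟩, hψn⟩ := (isContractible_iff _).1 (hψ.vertex w)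
    have hv := fun x => (isContractible_iff _).1 (hφ.vertex x)
    rw [isContractible_iff]
    set F := (φ.comp ψ).fiber w with hF
    have compD : ∀ d, (φ.comp ψ).onD d = (φ.onD d).elim (fun x => Sum.inl (ψ.onV x)) ψ.onD :=
      fun _ => rfl
    -- vertices over the same vertex are joined in the fiber
    have key0 : ∀ (x : G'.V) (hx : ψ.onV x = w) (a b : (φ.fiber x).V),
        Relation.ReflTransGen F.Adj ⟨a.1, (congrArg ψ.onV a.2).trans hx⟩
          ⟨b.1, (congrArg ψ.onV b.2).trans hx⟩ := by
      intro x hx a b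
      have h := (hv x).1.2 a b
      refine Relation.ReflTransGen.lift (p := F.Adj)
        (fun c : (φ.fiber x).V => (⟨c.1, (congrArg ψ.onV c.2).trans hx⟩ : F.V)) ?_ _ _ h
      rintro c e ⟨d, rfl, rfl⟩
      refine ⟨⟨d.1, ?_⟩, rfl, rfl⟩
      rw [compD, d.2]
      exact congrArg Sum.inl hx
    have key : ∀ y z : (ψ.fiber w).V, Relation.ReflTransGen (ψ.fiber w).Adj y z →
        ∀ (a b : F.V), φ.onV a.1 = y.1 → φ.onV b.1 = z.1 → Relation.ReflTransGen F.Adj a b := by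
      intro y z h
      induction h with
      | refl =>
        intro a b ha hb
        exact key0 y.1 y.2 ⟨a.1, ha⟩ ⟨b.1, hb⟩
      | @tail z t _ hzt ih =>
        intro a b ha hb
        obtain ⟨d', rfl, rfl⟩ := hzt
        obtain ⟨d, hd, _⟩ := hφ.edge d'.1
        have hdF : (φ.comp ψ).onD d = Sum.inl w := by
          rw [compD, hd]
          exact d'.2
        let dF : F.D := ⟨d, hdF⟩
        have h1 : φ.onV (F.src dF).1 = G'.src d'.1 := by
          change φ.onV (G.src d) = _
          rw [φ.onV_src, hd]
          rfl
        have h2 : φ.onV (F.src (F.rev dF)).1 = G'.src (G'.rev d'.1) := by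
          change φ.onV (G.src (G.rev d)) = _
          rw [φ.onV_src, φ.onD_rev, hd]
          rfl
        exact ((ih a _ ha h1).tail ⟨dF, rfl, rfl⟩).trans
          (key0 _ ((ψ.fiber w).src ((ψ.fiber w).rev d')).2 ⟨_, h2⟩ ⟨b.1, hb⟩)
    refine ⟨⟨?_, fun a b => ?_⟩, ?_⟩
    · obtain ⟨a⟩ := (hv y₀.1).1.1
      exact ⟨⟨a.1, (congrArg ψ.onV a.2).trans y₀.2⟩⟩
    · exact key ⟨φ.onV a.1, a.2⟩ ⟨φ.onV b.1, b.2⟩ (hψc _ _) a b rfl rfl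
    · have eV : F.V ≃ Σ y : (ψ.fiber w).V, (φ.fiber y.1).V :=
        { toFun := fun a => ⟨⟨φ.onV a.1, a.2⟩, ⟨a.1, rfl⟩⟩
          invFun := fun p => ⟨p.2.1, (congrArg ψ.onV p.2.2).trans p.1.2⟩
          left_inv := fun _ => rfl
          right_inv := by
            rintro ⟨⟨y, hy⟩, ⟨a, ha⟩⟩
            change φ.onV a = y at ha
            subst ha
            rfl }
      let fD : ((Σ y : (ψ.fiber w).V, (φ.fiber y.1).D) ⊕ (ψ.fiber w).D) → F.D := fun p =>
        p.elim
          (fun q => ⟨q.2.1, by rw [compD, q.2.2]; exact congrArg Sum.inl q.1.2⟩)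
          (fun d' => ⟨(hφ.edge d'.1).choose, by
            rw [compD, (hφ.edge d'.1).choose_spec.1]; exact d'.2⟩)
      have hfD : Function.Bijective fD := by
        constructor
        · rintro (⟨⟨y, hy⟩, ⟨d, hd⟩⟩ | d) (⟨⟨y', hy'⟩, ⟨d', hd'⟩⟩ | d') h
          · have h' : d = d' := congrArg Subtype.val h
            subst h'
            have : y = y' := Sum.inl_injective (hd.symm.trans hd')
            subst this
            rfl
          · have h' : d = (hφ.edge d'.1).choose := congrArg Subtype.val h
            have := (hφ.edge d'.1).choose_spec.1
            rw [← h'] at this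
            cases hd.symm.trans this
          · have h' : (hφ.edge d.1).choose = d' := congrArg Subtype.val h
            have := (hφ.edge d.1).choose_spec.1
            rw [h'] at this
            cases hd'.symm.trans this
          · have h' : (hφ.edge d.1).choose = (hφ.edge d'.1).choose := congrArg Subtype.val h
            have h1 := (hφ.edge d.1).choose_spec.1
            have h2 := (hφ.edge d'.1).choose_spec.1
            simp only at h1 h2
            rw [h', h2] at h1
            exact congrArg Sum.inr (Subtype.ext (Sum.inr_injective h1).symm)
        · rintro ⟨d, hd⟩
          rw [compD] at hd
          rcases hc : φ.onD d with x | d'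
          · rw [hc] at hd
            exact ⟨Sum.inl ⟨⟨x, Sum.inl_injective hd⟩, ⟨d, hc⟩⟩, rfl⟩
          · rw [hc] at hd
            refine ⟨Sum.inr ⟨d', hd⟩, Subtype.ext ?_⟩
            exact ((hφ.edge d').choose_spec.2 d hc).symm
      have := Fintype.ofFinite (ψ.fiber w).V
      rw [Nat.card_congr eV, ← Nat.card_congr (Equiv.ofBijective fD hfD), Nat.card_sum,
        Nat.card_sigma, Nat.card_sigma, add_assoc, hψn, Nat.card_eq_fintype_card,
        Finset.mul_sum, ← Finset.sum_congr rfl (fun (y : (ψ.fiber w).V) _ => (hv y.1).2),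
        Finset.sum_add_distrib]
      simp [mul_comm]

end Graph

/-! ### The contraction category -/

/-- The objects of the category of graphs of genus `g`. -/
structure GenusGraph (g : ℕ) where
  graph : Graph
  hasGenus : graph.HasGenus g

/-- The category of graphs of genus `g`, with contractions as morphisms. -/
instance (g : ℕ) : Category.{0} (GenusGraph g) where
  Hom G G' := {φ : Graph.Hom G.graph G'.graph // φ.IsContraction}
  id G := ⟨Graph.Hom.id G.graph, Graph.Hom.isContraction_id G.graph⟩
  comp φ ψ := ⟨φ.1.comp ψ.1, Graph.Hom.isContraction_comp φ.2 ψ.2⟩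
  id_comp _ := rfl
  comp_id φ := Subtype.ext <| Graph.Hom.ext rfl <| funext fun d => by
    change (φ.1.onD d).elim (fun x => Sum.inl x) Sum.inr = φ.1.onD d
    rcases φ.1.onD d with x | d' <;> rfl
  assoc φ ψ χ := Subtype.ext <| Graph.Hom.ext rfl <| funext fun d => by
    change ((φ.1.onD d).elim (fun x => Sum.inl (ψ.1.onV x)) ψ.1.onD).elim
      (fun x => Sum.inl (χ.1.onV x)) χ.1.onD =
      (φ.1.onD d).elim (fun x => Sum.inl (χ.1.onV (ψ.1.onV x)))
        (fun d => (ψ.1.onD d).elim (fun x => Sum.inl (χ.1.onV x)) χ.1.onD)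
    rcases φ.1.onD d with x | d' <;> rfl

/-! ### Gröbner categories -/

section Grobner

variable {C : Type u} [Category.{v} C]

/-- The set of equivalence classes of morphisms out of `x`, where `f : x ⟶ y` and `g : x ⟶ z` are
equivalent if there is an isomorphism `h : y ≅ z` with `f ≫ h.hom = g`, that is, if they are
isomorphic as objects of the category `Under x`. -/
def MorClass (x : C) : Type (max u v) := Quotient (isIsomorphicSetoid (Under x))

/-- The class of a morphism out of `x`. -/
def MorClass.mk {x y : C} (f : x ⟶ y) : MorClass x :=
  Quotient.mk (isIsomorphicSetoid (Under x)) (Under.mk f)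

/-- The quasi-order on classes of morphisms out of `x`: `f ≤ g` if `f ≫ h = g` for some `h`. -/
def MorClass.Divides {x : C} (a b : MorClass x) : Prop :=
  ∃ (y z : C) (f : x ⟶ y) (h : y ⟶ z), a = MorClass.mk f ∧ b = MorClass.mk (f ≫ h)

variable (C)

/-- Property (G1): for every object `x` the set of classes of morphisms out of `x` has a
well-order that is (strictly) compatible with post-composition. -/
def PropertyG1 : Prop :=
  ∀ x : C, ∃ L : LinearOrder (MorClass x), WellFounded L.lt ∧
    ∀ (y z : C) (f g : x ⟶ y) (h : y ⟶ z),
      L.lt (MorClass.mk f) (MorClass.mk g) → L.lt (MorClass.mk (f ≫ h)) (MorClass.mk (g ≫ h))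

/-- Property (G2): for no object `x` is there a bad sequence of classes of morphisms out of `x`,
that is, every sequence `a` has indices `i < j` with `a i ≤ a j`. -/
def PropertyG2 : Prop :=
  ∀ (x : C) (a : ℕ → MorClass x), ∃ i j : ℕ, i < j ∧ MorClass.Divides (a i) (a j)

/-- A category is Gröbner if it is essentially small, has properties (G1) and (G2), and has no
endomorphisms other than the identities. -/
structure IsGrobner : Prop where
  essentiallySmall : EssentiallySmall.{v} C
  g1 : PropertyG1 C
  g2 : PropertyG2 C
  endo : ∀ (x : C) (f : x ⟶ x), f = 𝟙 x

variable {C}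

/-- Property (F) of a functor. -/
def PropertyF {C' : Type u₁} [Category.{v₁} C'] (Φ : C' ⥤ C) : Prop :=
  ∀ x : C, ∃ (r : ℕ) (y : Fin r → C') (f : ∀ i, x ⟶ Φ.obj (y i)),
    ∀ (z : C') (h : x ⟶ Φ.obj z), ∃ (i : Fin r) (e : y i ⟶ z), h = f i ≫ Φ.map e

variable (C)

/-- A category is quasi-Gröbner if it admits an essentially surjective functor with property (F)
from a Gröbner category. -/
def IsQuasiGrobner : Prop :=
  ∃ (C' : Type u) (_ : Category.{v} C') (Φ : C' ⥤ C),
    IsGrobner C' ∧ Φ.EssSurj ∧ PropertyF Φ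

end Grobner

/-! ### Representations of categories -/

section Rep

/-- A representation `M : C ⥤ ModuleCat k` is finitely generated if there are finitely many
elements `m i ∈ M (x i)` whose images under all morphisms `x i ⟶ y` span `M y`, for every `y`. -/
def IsFinitelyGenerated {k : Type w} [CommRing k] {C : Type u} [Category.{v} C]
    (M : C ⥤ ModuleCat.{u₁} k) : Prop :=
  ∃ (r : ℕ) (x : Fin r → C) (m : ∀ i, M.obj (x i)), ∀ y : C,
    Submodule.span k {n : M.obj y | ∃ (i : Fin r) (f : x i ⟶ y), n = (M.map f).hom (m i)} = ⊤

/-- The category of representations `C ⥤ ModuleCat k` is locally Noetherian if every subobject of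
a finitely generated representation is finitely generated. -/
def RepLocallyNoetherian (k : Type w) [CommRing k] (C : Type u) [Category.{v} C] : Prop :=
  ∀ (M N : C ⥤ ModuleCat.{u₁} k) (ι : N ⟶ M), Mono ι →
    IsFinitelyGenerated M → IsFinitelyGenerated N

end Rep

end GraphContraction

/-! The algebra is a Gröbner basis argument. Over a Gröbner category, (G1) gives combinations of
morphisms a leading term, and (G2) together with the Noetherian ring leaves only finitely many
leading ideals to account for. Division with remainder, as in Hilbert's basis theorem, then shows
that every subrepresentation of a finitely generated one is finitely generated (`IsGrobner.subFG`).
A quasi-Gröbner category inherits this by pulling representations back along its functor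
(`IsQuasiGrobner.repLocallyNoetherian`).

The combinatorics covers graphs by planar trees. A connected graph of genus `g` is a spanning tree
with `g` further edges. Rooting the tree, ordering siblings, and numbering and orienting the further
edges yields a planar rooted tree with `g` pairs of marked vertices, the ends of those edges. When
only tree edges are contracted, the vertices to keep are the root and those whose edge to the parent
survives; every other vertex goes to its closest kept ancestor. Read backwards, such a contraction
is an embedding of planar trees. These embeddings form a Gröbner category (`PlanarTree.isGrobner`):
they are strictly increasing for the depth-first order, so endomorphisms are trivial and a
lexicographic order gives (G1), while (G2) is Kruskal's theorem with finitely many labels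
(`Forest.wellQuasiOrdered_emb`).

For property (F), a contraction of the graph of `T` onto `G` is performed by first contracting the
tree edges that it contracts. The tree edges left over inject into the edges of `G`, so only
finitely many intermediate trees occur (`PlanarTree.exists_small_factor`). Essential surjectivity is
the existence of spanning trees and of planar structures on them (`GenusGraph.exists_planarTree`).
-/

namespace GraphContraction

/-! ### Noetherianity of representations of quasi-Gröbner categories -/

section Noetherian

variable {k : Type w} [CommRing k] {C : Type u} [Category.{v} C]

theorem MorClass.mk_eq_mk {x y z : C} {f : x ⟶ y} {f' : x ⟶ z} :
    MorClass.mk f = MorClass.mk f' ↔ ∃ h : y ≅ z, f ≫ h.hom = f' := by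
  constructor
  · intro e
    obtain ⟨i⟩ := Quotient.exact (s := isIsomorphicSetoid (Under x)) e
    exact ⟨(Under.forget x).mapIso i, Under.w i.hom⟩
  · rintro ⟨h, e⟩
    exact Quotient.sound (s := isIsomorphicSetoid (Under x)) ⟨Under.isoMk h e⟩

theorem MorClass.divides_mk {x y z : C} {f : x ⟶ y} {f' : x ⟶ z} :
    MorClass.Divides (MorClass.mk f) (MorClass.mk f') ↔ ∃ h : y ⟶ z, f ≫ h = f' := by
  constructor
  · rintro ⟨y', z', g, h, e, e'⟩
    obtain ⟨i, hi⟩ := MorClass.mk_eq_mk.1 e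
    obtain ⟨j, hj⟩ := MorClass.mk_eq_mk.1 e'
    refine ⟨i.hom ≫ h ≫ j.inv, ?_⟩
    rw [← Category.assoc, hi, ← Category.assoc, ← hj]
    simp
  · rintro ⟨h, e⟩
    exact ⟨y, z, f, h, rfl, by rw [e]⟩

theorem MorClass.exists_rep {x : C} (a : MorClass x) :
    ∃ (y : C) (f : x ⟶ y), a = MorClass.mk f := by
  obtain ⟨f, rfl⟩ := Quotient.exists_rep a
  exact ⟨f.right, f.hom, rfl⟩

/-- An isomorphism relating two parallel morphisms is an endomorphism of their target, hence the
identity. So the well-order of (G1) totally orders each hom-set. -/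
theorem IsGrobner.mk_injective (hC : IsGrobner C) {x y : C} {f f' : x ⟶ y}
    (h : MorClass.mk f = MorClass.mk f') : f = f' := by
  obtain ⟨i, hi⟩ := MorClass.mk_eq_mk.1 h
  rw [← hi, hC.endo y i.hom, Category.comp_id]

/-- The subrepresentation generated by a set of elements. -/
def gen (M : C ⥤ ModuleCat.{u₁} k) (S : Set (Σ x : C, M.obj x)) (y : C) :
    Submodule k (M.obj y) :=
  Submodule.span k {n | ∃ p ∈ S, ∃ f : p.1 ⟶ y, n = (M.map f).hom p.2}

theorem gen_mono (M : C ⥤ ModuleCat.{u₁} k) {S S' : Set (Σ x : C, M.obj x)} (h : S ⊆ S')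
    (y : C) : gen M S y ≤ gen M S' y :=
  Submodule.span_mono (by rintro n ⟨p, hp, f, rfl⟩; exact ⟨p, h hp, f, rfl⟩)

theorem mem_gen (M : C ⥤ ModuleCat.{u₁} k) {S : Set (Σ x : C, M.obj x)} {x : C} {m : M.obj x}
    (h : ⟨x, m⟩ ∈ S) : m ∈ gen M S x :=
  Submodule.subset_span ⟨⟨x, m⟩, h, 𝟙 x, by simp⟩

/-- A family of submodules is a subrepresentation if it is stable under all structure maps. -/
def IsStable (M : C ⥤ ModuleCat.{u₁} k) (N : ∀ y, Submodule k (M.obj y)) : Prop :=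
  ∀ (y z : C) (h : y ⟶ z), ∀ n ∈ N y, (M.map h).hom n ∈ N z

theorem isStable_gen (M : C ⥤ ModuleCat.{u₁} k) (S : Set (Σ x : C, M.obj x)) :
    IsStable M (gen M S) := by
  intro y z h n hn
  have : gen M S y ≤ (gen M S z).comap (M.map h).hom := by
    refine Submodule.span_le.2 ?_
    rintro n ⟨p, hp, f, rfl⟩
    exact Submodule.subset_span ⟨p, hp, f ≫ h, by simp⟩
  exact this hn

theorem gen_le {M : C ⥤ ModuleCat.{u₁} k} {S : Set (Σ x : C, M.obj x)}
    {N : ∀ y, Submodule k (M.obj y)} (hN : IsStable M N) (h : ∀ p ∈ S, p.2 ∈ N p.1) (y : C) :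
    gen M S y ≤ N y := by
  refine Submodule.span_le.2 ?_
  rintro n ⟨p, hp, f, rfl⟩
  exact hN _ _ f _ (h p hp)

/-- A subrepresentation is finitely generated if it is generated by a finite set. -/
def SubFG (M : C ⥤ ModuleCat.{u₁} k) (N : ∀ y, Submodule k (M.obj y)) : Prop :=
  ∃ S : Set (Σ x : C, M.obj x), S.Finite ∧ ∀ y, gen M S y = N y

theorem isFinitelyGenerated_iff (M : C ⥤ ModuleCat.{u₁} k) :
    IsFinitelyGenerated M ↔ SubFG M (fun _ => ⊤) := by
  constructor
  · rintro ⟨r, x, m, h⟩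
    refine ⟨Set.range fun i => ⟨x i, m i⟩, Set.finite_range _, fun y => Eq.trans ?_ (h y)⟩
    refine congrArg _ (Set.ext fun n => ?_)
    simp
  · rintro ⟨S, hS, h⟩
    obtain ⟨r, e, he⟩ := hS.fin_param
    refine ⟨r, fun i => (e i).1, fun i => (e i).2, fun y => Eq.trans ?_ (h y)⟩
    refine congrArg _ (Set.ext fun n => ?_)
    simp [← he.2]

/-- The elements that are, modulo `M'`, combinations of the images of `m` under morphisms
in `s`. -/
def spanMod (M : C ⥤ ModuleCat.{u₁} k) {x : C} (m : M.obj x)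
    (M' : ∀ y, Submodule k (M.obj y)) {y : C} (s : Set (x ⟶ y)) : Submodule k (M.obj y) :=
  Submodule.span k ((fun f : x ⟶ y => (M.map f).hom m) '' s) ⊔ M' y

variable (M : C ⥤ ModuleCat.{u₁} k) {x : C} (m : M.obj x) (M' : ∀ y, Submodule k (M.obj y))

theorem map_mem_spanMod {m} {M'} (hM' : IsStable M M') {y z : C} (h : y ⟶ z) {s : Set (x ⟶ y)}
    {t : Set (x ⟶ z)} (hst : ∀ f ∈ s, f ≫ h ∈ t) {n : M.obj y} (hn : n ∈ spanMod M m M' s) :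
    (M.map h).hom n ∈ spanMod M m M' t := by
  have : spanMod M m M' s ≤ (spanMod M m M' t).comap (M.map h).hom := by
    refine sup_le (Submodule.span_le.2 ?_) fun n hn =>
      Submodule.mem_sup_right (hM' y z h n hn)
    rintro _ ⟨f, hf, rfl⟩
    refine Submodule.mem_sup_left (Submodule.subset_span ⟨f ≫ h, hst f hf, by simp⟩)
  exact this hn

/-- Only finitely many morphisms occur in a combination, so one of them has the largest key. The
first alternative covers the empty combination. -/
theorem exists_le_of_mem_spanMod {m} {M'} {y : C} {α : Type*} [LinearOrder α] (key : (x ⟶ y) → α)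
    {s : Set (x ⟶ y)} {n : M.obj y} (hn : n ∈ spanMod M m M' s) :
    n ∈ M' y ∨ ∃ f ∈ s, n ∈ spanMod M m M' {f' | key f' ≤ key f} := by
  obtain ⟨a, ha, b, hb, rfl⟩ := Submodule.mem_sup.1 hn
  have hmono : ∀ f f' : x ⟶ y, key f ≤ key f' →
      spanMod M m M' {g | key g ≤ key f} ≤ spanMod M m M' {g | key g ≤ key f'} := fun f f' h =>
    sup_le_sup_right (Submodule.span_mono (Set.image_mono fun g hg => le_trans hg h)) _
  have hM : ∀ f : x ⟶ y, M' y ≤ spanMod M m M' {g | key g ≤ key f} := fun f => le_sup_right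
  suffices a ∈ M' y ∨ ∃ f ∈ s, a ∈ spanMod M m M' {f' | key f' ≤ key f} by
    rcases this with h | ⟨f, hf, h⟩
    · exact Or.inl (add_mem h hb)
    · exact Or.inr ⟨f, hf, add_mem h (hM f hb)⟩
  clear hn
  induction ha using Submodule.span_induction with
  | mem a ha =>
    obtain ⟨f, hf, rfl⟩ := ha
    exact Or.inr ⟨f, hf, Submodule.mem_sup_left (Submodule.subset_span ⟨f, le_refl (key f), rfl⟩)⟩
  | zero => exact Or.inl (zero_mem _)
  | add a b _ _ iha ihb =>
    rcases iha with ha | ⟨f, hf, ha⟩ <;> rcases ihb with hb | ⟨f', hf', hb⟩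
    · exact Or.inl (add_mem ha hb)
    · exact Or.inr ⟨f', hf', add_mem (hM f' ha) hb⟩
    · exact Or.inr ⟨f, hf, add_mem ha (hM f hb)⟩
    · rcases le_total (key f) (key f') with h | h
      · exact Or.inr ⟨f', hf', add_mem (hmono _ _ h ha) hb⟩
      · exact Or.inr ⟨f, hf, add_mem ha (hmono _ _ h hb)⟩
  | smul c a _ iha =>
    rcases iha with ha | ⟨f, hf, ha⟩
    · exact Or.inl (Submodule.smul_mem _ _ ha)
    · exact Or.inr ⟨f, hf, Submodule.smul_mem _ _ ha⟩

/-- The ideal of the coefficients `c` for which `c • M f m` is congruent to an element of `N`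
modulo combinations of the images of `m` under morphisms in `s` and modulo `M'`. -/
def leadIdeal (N : ∀ y, Submodule k (M.obj y)) {y : C} (f : x ⟶ y) (s : Set (x ⟶ y)) : Ideal k :=
  (N y ⊔ spanMod M m M' s).comap (LinearMap.toSpanSingleton k (M.obj y) ((M.map f).hom m))

theorem mem_leadIdeal {m} {M'} {N : ∀ y, Submodule k (M.obj y)} {y : C} {f : x ⟶ y}
    {s : Set (x ⟶ y)} {c : k} : c ∈ leadIdeal M m M' N f s ↔
      ∃ n ∈ N y, n - c • (M.map f).hom m ∈ spanMod M m M' s := by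
  rw [leadIdeal, Submodule.mem_comap, LinearMap.toSpanSingleton_apply, Submodule.mem_sup]
  constructor
  · rintro ⟨n, hn, b, hb, e⟩
    exact ⟨n, hn, by rw [← e]; simpa using hb⟩
  · rintro ⟨n, hn, h⟩
    exact ⟨n, hn, _, neg_mem h, by abel⟩

/-- For `s` and `t` the morphisms below `f` and below `f ≫ h`, the condition `hst` is the
compatibility in (G1). Leading coefficients then pass to multiples. -/
theorem leadIdeal_le {m} {M'} {N : ∀ y, Submodule k (M.obj y)} (hN : IsStable M N)
    (hM' : IsStable M M') {y z : C} {f : x ⟶ y} (h : y ⟶ z)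
    {s : Set (x ⟶ y)} {t : Set (x ⟶ z)} (hst : ∀ f ∈ s, f ≫ h ∈ t) :
    leadIdeal M m M' N f s ≤ leadIdeal M m M' N (f ≫ h) t := by
  intro c hc
  obtain ⟨n, hn, hs⟩ := (mem_leadIdeal M).1 hc
  refine (mem_leadIdeal M).2 ⟨_, hN y z h n hn, ?_⟩
  simpa using map_mem_spanMod M hM' h hst hs

theorem exists_finite_leadIdeal [IsNoetherianRing k] (N : ∀ y, Submodule k (M.obj y)) {y : C}
    (f : x ⟶ y) (s : Set (x ⟶ y)) : ∃ S : Set (M.obj y), S.Finite ∧ S ⊆ N y ∧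
      ∀ c ∈ leadIdeal M m M' N f s, ∃ n ∈ Submodule.span k S,
        n - c • (M.map f).hom m ∈ spanMod M m M' s := by
  obtain ⟨t, ht⟩ := IsNoetherian.noetherian (leadIdeal M m M' N f s)
  have hex : ∀ c : t, ∃ n ∈ N y, n - c.1 • (M.map f).hom m ∈ spanMod M m M' s := fun c =>
    (mem_leadIdeal M).1 (ht ▸ Submodule.subset_span c.2)
  choose ν hν hν' using hex
  refine ⟨Set.range ν, Set.finite_range _, Set.range_subset_iff.2 hν, fun c hc => ?_⟩
  rw [← ht] at hc
  induction hc using Submodule.span_induction with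
  | mem c hc => exact ⟨_, Submodule.subset_span ⟨⟨c, hc⟩, rfl⟩, hν' _⟩
  | zero => exact ⟨0, zero_mem _, by simp⟩
  | add a b _ _ iha ihb =>
    obtain ⟨n, hn, h⟩ := iha
    obtain ⟨n', hn', h'⟩ := ihb
    refine ⟨n + n', add_mem hn hn', ?_⟩
    convert add_mem h h' using 1
    rw [add_smul]
    abel
  | smul a c _ ih =>
    obtain ⟨n, hn, h⟩ := ih
    refine ⟨a • n, Submodule.smul_mem _ _ hn, ?_⟩
    convert Submodule.smul_mem _ a h using 1
    rw [smul_sub, smul_smul, smul_eq_mul]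

theorem exists_finset_of_wellQuasiOrdered {α : Type*} {r : α → α → Prop}
    (h : WellQuasiOrdered r) : ∃ F : Finset α, ∀ a, ∃ b ∈ F, r b a := by
  by_contra! hcon
  obtain ⟨f, -, hf⟩ := exists_seq_of_forall_finset_exists (fun _ : α => True)
    (fun a b => ¬ r a b) fun s _ => by
      obtain ⟨a, ha⟩ := hcon s
      exact ⟨a, trivial, ha⟩
  obtain ⟨i, j, hij, hr⟩ := h f
  exact hf i j hij hr

/-- By (G2) any sequence has a subsequence increasing for divisibility. Along it the ideals ascend,
so they stabilize, and two consecutive late terms have the same ideal. -/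
theorem PropertyG2.wellQuasiOrdered [IsNoetherianRing k] (h2 : PropertyG2 C) (x : C)
    (I : (Σ y : C, (x ⟶ y)) → Ideal k)
    (hI : ∀ (y z : C) (f : x ⟶ y) (h : y ⟶ z), I ⟨y, f⟩ ≤ I ⟨z, f ≫ h⟩) :
    WellQuasiOrdered fun p q : Σ y : C, (x ⟶ y) =>
      (∃ h : p.1 ⟶ q.1, p.2 ≫ h = q.2) ∧ I q ≤ I p := by
  intro a
  let r : (Σ y : C, (x ⟶ y)) → (Σ y : C, (x ⟶ y)) → Prop := fun p q =>
    ∃ h : p.1 ⟶ q.1, p.2 ≫ h = q.2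
  have : IsPreorder _ r :=
    { refl := fun p => ⟨𝟙 _, by simp⟩
      trans := by
        rintro p q s ⟨h, e⟩ ⟨h', e'⟩
        exact ⟨h ≫ h', by rw [← Category.assoc, e, e']⟩ }
  have hr : WellQuasiOrdered r := fun b => by
    obtain ⟨i, j, hij, h⟩ := h2 x fun i => MorClass.mk (b i).2
    exact ⟨i, j, hij, MorClass.divides_mk.1 h⟩
  obtain ⟨g, hg⟩ := hr.exists_monotone_subseq a
  have hmono : ∀ p q, r p q → I p ≤ I q := by
    rintro ⟨y, f⟩ ⟨z, f'⟩ ⟨h, e⟩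
    exact (hI y z f h).trans (by rw [show f ≫ h = f' from e])
  obtain ⟨n, hn⟩ := monotone_stabilizes_iff_noetherian.2 (inferInstance : IsNoetherian k k)
    (⟨fun i => I (a (g i)), fun i j hij => hmono _ _ (hg i j hij)⟩ : ℕ →o Ideal k)
  exact ⟨g n, g (n + 1), g.strictMono n.lt_succ_self, hg _ _ n.le_succ,
    (hn (n + 1) n.le_succ).ge⟩

variable {M}

/-- Adding one generator to a Noetherian subrepresentation preserves Noetherianity. -/
theorem subFG_of_le_insert [IsNoetherianRing k] (hC : IsGrobner C) {S : Set (Σ x : C, M.obj x)}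
    (ih : ∀ N, IsStable M N → (∀ y, N y ≤ gen M S y) → SubFG M N)
    {N : ∀ y, Submodule k (M.obj y)} (hN : IsStable M N)
    (hle : ∀ y, N y ≤ gen M (insert ⟨x, m⟩ S) y) : SubFG M N := by
  obtain ⟨L, hwf, hL⟩ := hC.g1 x
  let key : ∀ y, (x ⟶ y) → MorClass x := fun y f => MorClass.mk f
  let low : ∀ y, (x ⟶ y) → Set (x ⟶ y) := fun y f => {f' | key y f' < key y f}
  have hS := isStable_gen M S
  have hlow : ∀ (y z : C) (f : x ⟶ y) (h : y ⟶ z), ∀ f' ∈ low y f, f' ≫ h ∈ low z (f ≫ h) :=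
    fun y z f h f' hf' => hL y z f' f h hf'
  let I : (Σ y : C, (x ⟶ y)) → Ideal k := fun p =>
    leadIdeal M m (gen M S) N p.2 (low p.1 p.2)
  -- Every morphism out of `x` is a multiple of one in the finite set `F` whose leading ideal is at
  -- least as large.
  obtain ⟨F, hF⟩ := exists_finset_of_wellQuasiOrdered (hC.g2.wellQuasiOrdered x I
    fun y z f h => leadIdeal_le M hN hS h (hlow y z f h))
  obtain ⟨S₁, hS₁, hgen₁⟩ := ih (fun y => N y ⊓ gen M S y)
    (fun y z h n hn => ⟨hN y z h n hn.1, hS y z h n hn.2⟩) fun y => inf_le_right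
  have hex := fun p : Σ y : C, (x ⟶ y) =>
    exists_finite_leadIdeal M m (gen M S) N p.2 (low p.1 p.2)
  choose T hTfin hTN hT using hex
  -- Generators of the part of `N` inside `gen M S`, and for each `p` in `F` finitely many elements
  -- of `N` whose combinations realize all leading coefficients at `p`.
  let S' : Set (Σ x : C, M.obj x) := S₁ ∪ ⋃ p ∈ F, (fun n => ⟨p.1, n⟩) '' T p
  have hSub : ∀ y, gen M S' y ≤ N y := by
    refine gen_le hN ?_
    rintro ⟨y, n⟩ (h | h)
    · have := mem_gen M h
      rw [hgen₁] at this
      exact this.1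
    · simp only [Set.mem_iUnion] at h
      obtain ⟨p, hp, n', hn', e⟩ := h
      cases e
      exact hTN p hn'
  -- Division with remainder, by well-founded induction on the class bounding the leading term:
  -- subtracting the image of a combination of some `T p` cancels that term.
  have hstep : ∀ (y : C) (c : MorClass x) (f : x ⟶ y), key y f = c → ∀ n ∈ N y,
      n ∈ spanMod M m (gen M S) {f' | key y f' ≤ key y f} → n ∈ gen M S' y := by
    intro y c
    induction c using hwf.induction with
    | _ c ihc =>
    rintro f rfl n hn hnf
    have hins : {f' | key y f' ≤ key y f} = insert f (low y f) := by
      ext f'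
      constructor
      · intro h
        rcases lt_or_eq_of_le (show key y f' ≤ key y f from h) with h | h
        · exact Or.inr h
        · exact Or.inl (hC.mk_injective h)
      · rintro (rfl | h)
        · exact le_refl (key y f')
        · exact le_of_lt (show key y f' < key y f from h)
    obtain ⟨c, hc⟩ : ∃ c : k, n - c • (M.map f).hom m ∈ spanMod M m (gen M S) (low y f) := by
      rw [hins, spanMod, Set.image_insert_eq] at hnf
      obtain ⟨a, ha, b, hb, rfl⟩ := Submodule.mem_sup.1 hnf
      obtain ⟨c, a', ha', rfl⟩ := Submodule.mem_span_insert.1 ha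
      refine ⟨c, Submodule.mem_sup.2 ⟨a', ha', b, hb, by abel⟩⟩
    obtain ⟨p, hpF, ⟨h, hp⟩, hI⟩ := hF ⟨y, f⟩
    obtain ⟨n', hn', hn'c⟩ := hT p c (hI ((mem_leadIdeal M).2 ⟨n, hn, hc⟩))
    have hn'S : n' ∈ gen M S' p.1 := by
      refine (Submodule.span_le.2 fun t ht => ?_) hn'
      refine mem_gen M (Or.inr ?_)
      simp only [Set.mem_iUnion]
      exact ⟨p, hpF, t, ht, rfl⟩
    have hn'S' := isStable_gen M S' _ _ h n' hn'S
    have hd : n - (M.map h).hom n' ∈ spanMod M m (gen M S) (low y f) := by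
      have h1 := map_mem_spanMod M hS h (hlow p.1 y p.2 h) hn'c
      simp only at hp
      rw [hp] at h1
      have h2 : (M.map h).hom (n' - c • (M.map p.2).hom m)
          = (M.map h).hom n' - c • (M.map f).hom m := by
        rw [← hp]
        simp
      rw [h2] at h1
      convert sub_mem hc h1 using 1
      abel
    have hdN : n - (M.map h).hom n' ∈ N y := sub_mem hn (hSub y hn'S')
    suffices n - (M.map h).hom n' ∈ gen M S' y by
      simpa using add_mem this hn'S'
    rcases exists_le_of_mem_spanMod M (key y) hd with h0 | ⟨f', hf', h0⟩
    · refine gen_mono M Set.subset_union_left y ?_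
      rw [hgen₁]
      exact ⟨hdN, h0⟩
    · exact ihc _ hf' f' rfl _ hdN h0
  refine ⟨S', hS₁.union (F.finite_toSet.biUnion fun p _ => (hTfin p).image _), fun y =>
    le_antisymm (hSub y) fun n hn => ?_⟩
  have hn' : n ∈ spanMod M m (gen M S) (Set.univ : Set (x ⟶ y)) := by
    refine (Submodule.span_le.2 ?_ : gen M (insert ⟨x, m⟩ S) y ≤ _) (hle y hn)
    rintro n ⟨p, rfl | hp, f, rfl⟩
    · exact Submodule.mem_sup_left (Submodule.subset_span ⟨f, trivial, rfl⟩)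
    · exact Submodule.mem_sup_right (Submodule.subset_span ⟨p, hp, f, rfl⟩)
  rcases exists_le_of_mem_spanMod M (key y) hn' with h0 | ⟨f', hf', h0⟩
  · refine gen_mono M Set.subset_union_left y ?_
    rw [hgen₁]
    exact ⟨hn, h0⟩
  · exact hstep y _ f' rfl n hn h0

theorem IsGrobner.subFG [IsNoetherianRing k] (hC : IsGrobner C) {S : Set (Σ x : C, M.obj x)}
    (hS : S.Finite) : ∀ N, IsStable M N → (∀ y, N y ≤ gen M S y) → SubFG M N := by
  induction S, hS using Set.Finite.induction_on with
  | empty =>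
    intro N _ h
    refine ⟨∅, Set.finite_empty, fun y => le_antisymm ?_ (h y)⟩
    exact Submodule.span_le.2 (by rintro n ⟨p, hp, -⟩; exact hp.elim)
  | insert _ _ ih =>
    rename_i p S _ _
    intro N hN h
    exact subFG_of_le_insert (x := p.1) p.2 hC ih hN h

/-- Property (F) makes `Φ ⋙ M` finitely generated, so the pullback of the image of `N` is finitely
generated over `C'`. Its generators, lifted through the injective `ι`, generate `N` at the objects
`Φ.obj z`; essential surjectivity reaches the others. -/
theorem IsQuasiGrobner.repLocallyNoetherian [IsNoetherianRing k] (hC : IsQuasiGrobner C) :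
    RepLocallyNoetherian.{u, v, u₁, w} k C := by
  intro M N ι hι hM
  obtain ⟨C', _, Φ, hC', hess, hF⟩ := hC
  obtain ⟨S, hS, hgen⟩ := (isFinitelyGenerated_iff M).1 hM
  have hinj : ∀ y, Function.Injective (ι.app y).hom := fun y =>
    (ModuleCat.mono_iff_injective _).1 ((NatTrans.mono_iff_mono_app ι).1 hι y)
  have hnat : ∀ (y z : C) (h : y ⟶ z) (n : N.obj y),
      (ι.app z).hom ((N.map h).hom n) = (M.map h).hom ((ι.app y).hom n) := fun y z h n =>
    congrArg (fun a : N.obj y ⟶ M.obj z => a.hom n) (ι.naturality h)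
  let R : ∀ y, Submodule k (M.obj y) := fun y => LinearMap.range (ι.app y).hom
  have hR : IsStable M R := by
    rintro y z h _ ⟨n, rfl⟩
    exact ⟨(N.map h).hom n, hnat y z h n⟩
  choose r y f hf using hF
  let T : Set (Σ z : C', (Φ ⋙ M).obj z) := ⋃ p ∈ S, Set.range fun i : Fin (r p.1) =>
    ⟨y p.1 i, (M.map (f p.1 i)).hom p.2⟩
  have hT : T.Finite := hS.biUnion fun p _ => Set.finite_range _
  have hTtop : ∀ z, gen (Φ ⋙ M) T z = ⊤ := by
    intro z
    refine eq_top_iff.2 ((hgen (Φ.obj z)).ge.trans ?_)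
    refine Submodule.span_le.2 ?_
    rintro n ⟨p, hp, h, rfl⟩
    obtain ⟨i, e, rfl⟩ := hf p.1 z h
    refine Submodule.subset_span ⟨⟨y p.1 i, (M.map (f p.1 i)).hom p.2⟩, ?_, e, by simp⟩
    simp only [T, Set.mem_iUnion]
    exact ⟨p, hp, i, rfl⟩
  obtain ⟨U, hU, hUgen⟩ := hC'.subFG (M := Φ ⋙ M) hT (fun z => R (Φ.obj z))
    (fun y z h n hn => hR _ _ (Φ.map h) n hn) (fun z => by rw [hTtop]; exact le_top)
  have hUR : ∀ p ∈ U, ∃ n : N.obj (Φ.obj p.1), (ι.app _).hom n = p.2 := by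
    rintro ⟨z, n⟩ hp
    have := mem_gen (Φ ⋙ M) hp
    rw [hUgen] at this
    exact this
  choose! ν hν using hUR
  refine (isFinitelyGenerated_iff N).2 ⟨(fun p => ⟨Φ.obj p.1, ν p⟩) '' U, hU.image _,
    fun z => eq_top_iff.2 fun n _ => ?_⟩
  set V : Set (Σ x : C, N.obj x) := (fun p : (Σ z : C', (Φ ⋙ M).obj z) =>
    (⟨Φ.obj p.1, ν p⟩ : Σ x : C, N.obj x)) '' U with hV
  have hobj : ∀ (z : C') (n : N.obj (Φ.obj z)), n ∈ gen N V (Φ.obj z) := by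
    intro z n
    have h1 : (ι.app _).hom n ∈ gen (Φ ⋙ M) U z := by
      rw [hUgen]
      exact ⟨n, rfl⟩
    have h2 : gen (Φ ⋙ M) U z ≤ (gen N V (Φ.obj z)).map (ι.app _).hom := by
      refine Submodule.span_le.2 ?_
      rintro _ ⟨p, hp, e, rfl⟩
      refine ⟨(N.map (Φ.map e)).hom (ν p), Submodule.subset_span
        ⟨_, ⟨p, hp, rfl⟩, Φ.map e, rfl⟩, ?_⟩
      rw [hnat, hν p hp]
      rfl
    obtain ⟨n', hn', e⟩ := h2 h1
    rwa [← hinj _ e]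
  have i := Φ.objObjPreimageIso z
  have := isStable_gen N V _ _ i.hom _ (hobj _ ((N.map i.inv).hom n))
  have e : (N.map i.hom).hom ((N.map i.inv).hom n) = n := by
    rw [← ModuleCat.comp_apply, ← N.map_comp, i.inv_hom_id, N.map_id]
    rfl
  rwa [e] at this

end Noetherian

end GraphContraction

namespace GraphContraction

/-! ### Kruskal's theorem for planar forests -/

/-- Planar rooted forests with labelled vertices: a non-empty forest has a first tree, with a
labelled root over the forest `c`, and a remaining forest `r`. -/
inductive Forest (α : Type*) where
  | nil : Forest α
  | node (a : α) (c r : Forest α) : Forest α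

namespace Forest

variable {α : Type*}

/-- The number of vertices of a forest. -/
def size : Forest α → ℕ
  | nil => 0
  | node _ c r => c.size + r.size + 1

/-- Embeddability of forests. -/
inductive Emb : Forest α → Forest α → Prop
  | nil (f : Forest α) : Emb nil f
  | left {f c : Forest α} (a : α) (r : Forest α) : Emb f c → Emb f (node a c r)
  | right {f r : Forest α} (a : α) (c : Forest α) : Emb f r → Emb f (node a c r)
  | node {c c' r r' : Forest α} (a : α) : Emb c c' → Emb r r' → Emb (node a c r) (node a c' r')

theorem Emb.refl : ∀ f : Forest α, Emb f f
  | .nil => .nil _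
  | .node a c r => .node a (Emb.refl c) (Emb.refl r)

theorem Emb.trans {f f' f'' : Forest α} (h : Emb f f') (h' : Emb f' f'') : Emb f f'' := by
  induction h' generalizing f with
  | nil => cases h; exact .nil _
  | left a r _ ih => exact .left a r (ih h)
  | right a c _ ih => exact .right a c (ih h)
  | node a _ _ ihc ihr =>
    cases h with
    | nil => exact .nil _
    | left _ _ h => exact .left _ _ (ihc h)
    | right _ _ h => exact .right _ _ (ihr h)
    | node _ h h' => exact .node a (ihc h) (ihr h')

/-- The forest of the children of the first root, or the forest of the remaining trees. -/
inductive IsPart : Forest α → Forest α → Prop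
  | left (a : α) (c r : Forest α) : IsPart c (node a c r)
  | right (a : α) (c r : Forest α) : IsPart r (node a c r)

theorem IsPart.size_lt {f f' : Forest α} (h : IsPart f f') : f.size < f'.size := by
  cases h <;> simp only [size] <;> omega

theorem IsPart.emb {f f' f'' : Forest α} (h : IsPart f' f'') (h' : Emb f f') : Emb f f'' := by
  cases h
  · exact .left _ _ h'
  · exact .right _ _ h'

/-- **Kruskal's theorem** for planar forests with finitely many labels. -/
theorem wellQuasiOrdered_emb [Finite α] : WellQuasiOrdered (Emb (α := α)) := by
  rw [← Set.partiallyWellOrderedOn_univ_iff,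
    Set.PartiallyWellOrderedOn.iff_not_exists_isMinBadSeq size]
  rintro ⟨f, hf, hmin⟩
  have hparts : WellQuasiOrdered fun p q : {p : Forest α // ∃ i, IsPart p (f i)} =>
      Emb p.1 q.1 := by
    intro h
    by_contra! hbad
    choose i hi using fun n => (h n).2
    -- Among the terms of `h`, take one whose ambient forest comes earliest in `f`. Following the
    -- terms of `f` before index `i n₀` by `h n₀, h (n₀ + 1), …` gives a bad sequence with a smaller
    -- entry at `i n₀`, against minimality.
    obtain ⟨n₀, hn₀⟩ := exists_minimal_of_wellFoundedLT (fun j => ∃ n, i n = j) ⟨_, 0, rfl⟩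
    obtain ⟨⟨n₀, rfl⟩, hle⟩ := hn₀
    have hle' : ∀ n, i n₀ ≤ i n := fun n => by
      by_contra! hlt
      exact absurd (hle ⟨n, rfl⟩ hlt.le) (not_le.2 hlt)
    refine hmin (i n₀) (fun n => if n < i n₀ then f n else (h (n₀ + (n - i n₀))).1)
      (fun m hm => (if_pos hm).symm) ?_ ⟨fun _ => trivial, fun m n hmn => ?_⟩
    · simpa using (hi n₀).size_lt
    · by_cases hn : n < i n₀
      · simp only [if_pos hn, if_pos (hmn.trans hn)]
        exact hf.2 m n hmn
      · by_cases hm : m < i n₀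
        · simp only [if_neg hn, if_pos hm]
          exact fun he => hf.2 m _ (hm.trans_le (hle' _)) ((hi _).emb he)
        · simp only [if_neg hn, if_neg hm]
          exact hbad _ _ (by omega)
  have : IsPreorder {p : Forest α // ∃ i, IsPart p (f i)} fun p q => Emb p.1 q.1 :=
    { refl := fun p => Emb.refl _
      trans := fun p q r => Emb.trans }
  have hne : ∀ i, ∃ a c r, f i = node a c r := by
    intro i
    rcases h : f i with _ | ⟨a, c, r⟩
    · exact absurd (h ▸ Emb.nil _) (hf.2 i (i + 1) i.lt_succ_self)
    · exact ⟨a, c, r, rfl⟩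
  choose a c r hacr using hne
  -- Root labels, forests of children and remaining forests are well-quasi-ordered, hence so are the
  -- triples of them.
  obtain ⟨i, j, hij, ha, hc, hr⟩ :=
    (Finite.wellQuasiOrdered (α := α) (· = ·)).prod (hparts.prod hparts) fun i =>
      (a i, ⟨c i, i, by rw [hacr]; exact .left _ _ _⟩, ⟨r i, i, by rw [hacr]; exact .right _ _ _⟩)
  refine hf.2 i j hij ?_
  rw [hacr i, hacr j]
  simp only at ha hc hr
  rw [ha]
  exact .node _ hc hr

end Forest

/-- A relation on a linearly ordered set `V` is the ancestor relation of a planar rooted forest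
whose depth-first order is the order of `V`. -/
structure IsPlanar {V : Type*} [LinearOrder V] (anc : V → V → Prop) : Prop where
  refl : ∀ a, anc a a
  le : ∀ {a b}, anc a b → a ≤ b
  trans : ∀ {a b c}, anc a b → anc b c → anc a c
  interval : ∀ {a b c}, a ≤ b → b ≤ c → anc a c → anc a b

/-! ### Encoding planar trees as labelled forests, and turning embeddings of forests into maps of
vertices -/

namespace Forest

variable {α : Type*}

/-- The forest `f` describes the vertices in `s`, in a planar forest with labels `l`. -/
inductive Describes {V : Type*} [LinearOrder V] (anc : V → V → Prop) (l : V → α) :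
    Forest α → Set V → Prop
  | nil : Describes anc l nil ∅
  | node {f f' : Forest α} (m : V) {c r : Set V} (hc : ∀ v ∈ c, anc m v ∧ m < v)
      (hr : ∀ v ∈ r, ¬ anc m v ∧ m < v) (hcr : ∀ v ∈ c, ∀ w ∈ r, v < w) :
      Describes anc l f c → Describes anc l f' r →
      Describes anc l (node (l m) f f') (insert m (c ∪ r))

/-- The least vertex of `s` is the first root. The other vertices split into its descendants and the
rest, and the `interval` axiom puts all the former before the latter. -/
theorem exists_describes {V : Type*} [LinearOrder V] {anc : V → V → Prop} (h : IsPlanar anc)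
    (l : V → α) (s : Finset V) : ∃ f, Describes anc l f (s : Set V) := by
  classical
  induction s using Finset.strongInduction with
  | H s ih =>
  rcases s.eq_empty_or_nonempty with rfl | hs
  · exact ⟨nil, by simpa using Describes.nil⟩
  · set m := s.min' hs with hm
    have hms : m ∈ s := s.min'_mem hs
    have hlt : ∀ v ∈ s.erase m, m < v := fun v hv =>
      lt_of_le_of_ne (s.min'_le v (Finset.mem_of_mem_erase hv)) (Finset.ne_of_mem_erase hv).symm
    have hss : ∀ p : V → Prop, (s.erase m).filter p ⊂ s := fun p =>
      (Finset.filter_subset _ _).trans_ssubset (Finset.erase_ssubset hms)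
    obtain ⟨f, hf⟩ := ih _ (hss fun v => anc m v)
    obtain ⟨f', hf'⟩ := ih _ (hss fun v => ¬ anc m v)
    refine ⟨node (l m) f f', ?_⟩
    have e : (s : Set V) = insert m
        (((s.erase m).filter (fun v => anc m v) : Set V) ∪ (s.erase m).filter fun v => ¬ anc m v) := by
      rw [← Finset.coe_union, Finset.filter_union_filter_not_eq, ← Finset.coe_insert,
        Finset.insert_erase hms]
    rw [e]
    refine Describes.node m (fun v hv => ?_) (fun v hv => ?_) (fun v hv w hw => ?_) hf
      (by convert hf')
    · have := Finset.mem_filter.1 hv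
      exact ⟨this.2, hlt v this.1⟩
    · have := Finset.mem_filter.1 hv
      exact ⟨this.2, hlt v this.1⟩
    · have hv := Finset.mem_filter.1 hv
      have hw := Finset.mem_filter.1 hw
      by_contra! hle
      exact hw.2 (h.interval (hlt w hw.1).le hle hv.2)

/-- The map is glued along the recursion of `Emb`: matched roots correspond, descendants follow one
embedding and the remaining vertices the other. Order and ancestry between different blocks are
forced by the side conditions in `Describes`. -/
theorem Emb.exists_map {V W : Type*} [LinearOrder V] [LinearOrder W] [Nonempty W]
    {anc : V → V → Prop} {anc' : W → W → Prop} (h : IsPlanar anc) (h' : IsPlanar anc')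
    {l : V → α} {l' : W → α} {f f' : Forest α} (hff' : Emb f f') {s : Set V} {t : Set W}
    (hf : Describes anc l f s) (hf' : Describes anc' l' f' t) :
    ∃ φ : V → W, (∀ v ∈ s, φ v ∈ t ∧ l' (φ v) = l v) ∧
      ∀ v ∈ s, ∀ w ∈ s, (v < w → φ v < φ w) ∧ (anc' (φ v) (φ w) ↔ anc v w) := by
  classical
  induction hff' generalizing s t with
  | nil f =>
    cases hf
    exact ⟨fun _ => Classical.arbitrary W, by simp⟩
  | left a r _ ih =>
    cases hf' with
    | node m hc hr hcr hf₁ hf₂ =>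
    obtain ⟨φ, h1, h2⟩ := ih hf hf₁
    exact ⟨φ, fun v hv => ⟨Or.inr (Or.inl (h1 v hv).1), (h1 v hv).2⟩, h2⟩
  | right a c _ ih =>
    cases hf' with
    | node m hc hr hcr hf₁ hf₂ =>
    obtain ⟨φ, h1, h2⟩ := ih hf hf₂
    exact ⟨φ, fun v hv => ⟨Or.inr (Or.inr (h1 v hv).1), (h1 v hv).2⟩, h2⟩
  | node a _ _ ihc ihr =>
    generalize ha : a = b at hf'
    cases hf with
    | @node _ _ m c r hc hr hcr hf₁ hf₂ =>
    cases hf' with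
    | @node _ _ m' c' r' hc' hr' hcr' hf₁' hf₂' =>
    obtain ⟨φ₁, h₁, h₁'⟩ := ihc hf₁ hf₁'
    obtain ⟨φ₂, h₂, h₂'⟩ := ihr hf₂ hf₂'
    let φ : V → W := fun v => if v = m then m' else if anc m v then φ₁ v else φ₂ v
    have em : φ m = m' := if_pos rfl
    have ec : ∀ v ∈ c, φ v = φ₁ v := fun v hv =>
      (if_neg (hc v hv).2.ne').trans (if_pos (hc v hv).1)
    have er : ∀ v ∈ r, φ v = φ₂ v := fun v hv =>
      (if_neg (hr v hv).2.ne').trans (if_neg (hr v hv).1)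
    refine ⟨φ, ?_, ?_⟩
    · rintro v (rfl | hv | hv)
      · rw [em]
        exact ⟨Or.inl rfl, ha.symm⟩
      · rw [ec v hv]
        exact ⟨Or.inr (Or.inl (h₁ v hv).1), (h₁ v hv).2⟩
      · rw [er v hv]
        exact ⟨Or.inr (Or.inr (h₂ v hv).1), (h₂ v hv).2⟩
    · rintro v (rfl | hv | hv) w (rfl | hw | hw)
      · exact ⟨fun hlt => absurd hlt (lt_irrefl _), iff_of_true (h'.refl _) (h.refl _)⟩
      · rw [em, ec w hw]
        have := hc' _ (h₁ w hw).1
        exact ⟨fun _ => this.2, iff_of_true this.1 (hc w hw).1⟩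
      · rw [em, er w hw]
        have := hr' _ (h₂ w hw).1
        exact ⟨fun _ => this.2, iff_of_false this.1 (hr w hw).1⟩
      · rw [em, ec v hv]
        have h3 := (hc' _ (h₁ v hv).1).2
        have h4 := (hc v hv).2
        exact ⟨fun hlt => absurd hlt h4.not_gt,
          iff_of_false (fun e => (h'.le e).not_gt h3) fun e => (h.le e).not_gt h4⟩
      · rw [ec v hv, ec w hw]
        exact h₁' v hv w hw
      · rw [ec v hv, er w hw]
        exact ⟨fun _ => hcr' _ (h₁ v hv).1 _ (h₂ w hw).1,
          iff_of_false
            (fun e => (hr' _ (h₂ w hw).1).1 (h'.trans (hc' _ (h₁ v hv).1).1 e))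
            fun e => (hr w hw).1 (h.trans (hc v hv).1 e)⟩
      · rw [em, er v hv]
        have h3 := (hr' _ (h₂ v hv).1).2
        have h4 := (hr v hv).2
        exact ⟨fun hlt => absurd hlt h4.not_gt,
          iff_of_false (fun e => (h'.le e).not_gt h3) fun e => (h.le e).not_gt h4⟩
      · rw [er v hv, ec w hw]
        have h3 := hcr' _ (h₁ w hw).1 _ (h₂ v hv).1
        have h4 := hcr w hw v hv
        exact ⟨fun hlt => absurd hlt h4.not_gt,
          iff_of_false (fun e => (h'.le e).not_gt h3) fun e => (h.le e).not_gt h4⟩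
      · rw [er v hv, er w hw]
        exact h₂' v hv w hw

end Forest

end GraphContraction

namespace GraphContraction

/-! ### Planar rooted trees with marked vertices -/

/-- A planar rooted tree, with vertices numbered in depth-first order and with `g` pairs of marked
vertices. -/
structure PlanarTree (g : ℕ) : Type 1 where
  n : ℕ
  anc : Fin (n + 1) → Fin (n + 1) → Prop
  planar : IsPlanar anc
  root : ∀ v, anc 0 v
  mark : Fin g × Bool → Fin (n + 1)

/-- A planar embedding of the vertices of `S` into those of `T` that preserves the root and the
ancestor relation. The last condition says that each marked vertex of `S` is the closest ancestor
in `S` of the corresponding marked vertex of `T`. -/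
@[ext]
structure PlanarTree.Hom {g : ℕ} (S T : PlanarTree g) where
  toFun : Fin (S.n + 1) → Fin (T.n + 1)
  strictMono : StrictMono toFun
  anc_iff : ∀ v w, T.anc (toFun v) (toFun w) ↔ S.anc v w
  root : toFun 0 = 0
  mark : ∀ v m, S.anc v (S.mark m) ↔ T.anc (toFun v) (T.mark m)

instance (g : ℕ) : Category.{0} (PlanarTree g) where
  Hom := PlanarTree.Hom
  id S := ⟨fun v => v, strictMono_id, fun _ _ => Iff.rfl, rfl, fun _ _ => Iff.rfl⟩
  comp f h := ⟨fun v => h.toFun (f.toFun v), h.strictMono.comp f.strictMono,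
    fun _ _ => (h.anc_iff _ _).trans (f.anc_iff _ _), (congrArg h.toFun f.root).trans h.root,
    fun _ _ => (f.mark _ _).trans (h.mark _ _)⟩

namespace PlanarTree

variable {g : ℕ}

@[ext]
theorem hom_ext {S T : PlanarTree g} {f f' : S ⟶ T} (h : ∀ v, f.toFun v = f'.toFun v) : f = f' :=
  Hom.ext (funext h)

@[simp]
theorem comp_toFun {S T U : PlanarTree g} (f : S ⟶ T) (h : T ⟶ U) (v : Fin (S.n + 1)) :
    (f ≫ h).toFun v = h.toFun (f.toFun v) := rfl

theorem Hom.injective {S T : PlanarTree g} (f : Hom S T) : Function.Injective f.toFun :=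
  f.strictMono.injective

theorem le_toFun {S T : PlanarTree g} (f : S ⟶ T) (v : Fin (S.n + 1)) :
    (v : ℕ) ≤ f.toFun v := by
  obtain ⟨v, hv⟩ := v
  induction v with
  | zero => exact Nat.zero_le _
  | succ v ih =>
    have h1 := ih (by omega)
    have h2 := f.strictMono (show (⟨v, by omega⟩ : Fin (S.n + 1)) < ⟨v + 1, hv⟩ from
      Nat.lt_succ_self v)
    have h3 : (f.toFun ⟨v, by omega⟩ : ℕ) < f.toFun ⟨v + 1, hv⟩ := h2
    simp only at h1 ⊢
    omega

/-- A strictly increasing map never lowers the number of a vertex; this applies to both directions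
of `i`. -/
theorem val_iso_hom {S T : PlanarTree g} (i : S ≅ T) (v : Fin (S.n + 1)) :
    (i.hom.toFun v : ℕ) = v := by
  refine le_antisymm ?_ (le_toFun i.hom v)
  have := le_toFun i.inv (i.hom.toFun v)
  rwa [← comp_toFun, i.hom_inv_id] at this

theorem endo_eq_id {S : PlanarTree g} (f : S ⟶ S) : f = 𝟙 S :=
  Hom.ext f.strictMono.eq_id

theorem finite_le (N : ℕ) : Finite {S : PlanarTree g // S.n ≤ N} := by
  let c : {S : PlanarTree g // S.n ≤ N} → Σ n : Fin (N + 1),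
      (Fin (n.1 + 1) → Fin (n.1 + 1) → Prop) × (Fin g × Bool → Fin (n.1 + 1)) := fun S =>
    ⟨⟨S.1.n, Nat.lt_succ_of_le S.2⟩, S.1.anc, S.1.mark⟩
  refine Finite.of_injective c ?_
  rintro ⟨⟨n, a, p, r, m⟩, h⟩ ⟨⟨n', a', p', r', m'⟩, h'⟩ e
  simp only [c, Sigma.mk.injEq, Fin.mk.injEq] at e
  obtain ⟨rfl, e⟩ := e
  simp only [heq_eq_eq, Prod.mk.injEq] at e
  obtain ⟨rfl, rfl⟩ := e
  rfl

/-- This gives essential smallness: `PlanarTree g` is placed in `Type 1` because `IsQuasiGrobner`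
asks for the universe of `GenusGraph g`. -/
instance : Countable (PlanarTree g) := by
  have := fun N => finite_le (g := g) N
  let c : PlanarTree g → Σ N : ℕ, {S : PlanarTree g // S.n ≤ N} := fun S => ⟨S.n, S, le_rfl⟩
  refine Function.Injective.countable (f := c) fun S T e => ?_
  have := congrArg (fun p : Σ N : ℕ, {S : PlanarTree g // S.n ≤ N} => p.2.1) e
  exact this

/-- The isomorphism class of the target of a morphism, and the positions of the images of the
vertices of the source. -/
def key (S : PlanarTree g) (f : Under S) :
    Quotient (isIsomorphicSetoid (PlanarTree g)) × (Fin (S.n + 1) → ℕ) :=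
  (Quotient.mk _ f.right, fun v => f.hom.toFun v)

theorem key_eq_iff (S : PlanarTree g) (f f' : Under S) :
    key S f = key S f' ↔ Nonempty (f ≅ f') := by
  constructor
  · intro e
    obtain ⟨i⟩ := Quotient.exact (congrArg Prod.fst e)
    refine ⟨Under.isoMk i ?_⟩
    ext v
    have h := congrFun (congrArg Prod.snd e) v
    rw [← show (f.hom.toFun v : ℕ) = f'.hom.toFun v from h]
    exact val_iso_hom i _
  · rintro ⟨i⟩
    refine Prod.ext (Quotient.sound ⟨(Under.forget S).mapIso i⟩) (funext fun v => ?_)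
    have h := val_iso_hom ((Under.forget S).mapIso i) (f.hom.toFun v)
    have e : f'.hom = f.hom ≫ ((Under.forget S).mapIso i).hom := (Under.w i.hom).symm
    change (f.hom.toFun v : ℕ) = f'.hom.toFun v
    rw [e]
    exact h.symm

/-- Classes are compared first by target, in an arbitrary well-order, then lexicographically by the
positions of the images. Parallel morphisms tie in the first comparison; at the first vertex where
they differ, a strictly increasing `h` keeps the inequality. -/
theorem propertyG1 : PropertyG1 (PlanarTree g) := by
  classical
  intro S
  let K := Quotient (isIsomorphicSetoid (PlanarTree g))
  let _ : LinearOrder K := linearOrderOfSTO WellOrderingRel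
  have : WellFoundedLT K := ⟨(WellOrderingRel.isWellOrder (α := K)).wf⟩
  let κ : MorClass S → K ×ₗ Lex (Fin (S.n + 1) → ℕ) := Quotient.lift
    (fun f => toLex ((key S f).1, toLex (key S f).2)) fun f f' h => by
      rw [(key_eq_iff S f f').2 h]
  have hκ : Function.Injective κ := by
    rintro ⟨f⟩ ⟨f'⟩ e
    refine Quotient.sound ((key_eq_iff S f f').1 ?_)
    exact e
  refine ⟨LinearOrder.lift' κ hκ, InvImage.wf κ wellFounded_lt, ?_⟩
  intro T U f f' h hlt
  change κ (MorClass.mk f) < κ (MorClass.mk f') at hlt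
  change κ (MorClass.mk (f ≫ h)) < κ (MorClass.mk (f' ≫ h))
  rcases Prod.Lex.lt_iff.1 hlt with h1 | ⟨-, h2⟩
  · exact absurd h1 (lt_irrefl _)
  · refine Prod.Lex.lt_iff.2 (Or.inr ⟨rfl, ?_⟩)
    obtain ⟨i, hi, hi'⟩ := h2
    refine ⟨i, fun j hj => ?_, h.strictMono (show f.toFun i < f'.toFun i from hi')⟩
    have : f.toFun j = f'.toFun j := Fin.ext (hi j hj)
    exact congrArg (fun v => ((h.toFun v : Fin (U.n + 1)) : ℕ)) this

/-- The labels of the vertex `w` in a tree under `S`. -/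
def label {S T : PlanarTree g} (f : S ⟶ T) (w : Fin (T.n + 1)) :
    Set (Fin (S.n + 1) ⊕ (Fin g × Bool)) :=
  {z | z.elim f.toFun T.mark = w}

/-- The label of a vertex records which vertices of `S` and which marks sit there, so there are
finitely many labels. An embedding preserving labels commutes with the maps from `S` and carries
marks to marks, hence is a morphism under `S`. -/
theorem propertyG2 : PropertyG2 (PlanarTree g) := by
  intro S a
  choose T f hf using fun i => (a i).exists_rep
  choose F hF using fun i =>
    Forest.exists_describes (T i).planar (label (f i)) (Finset.univ : Finset (Fin ((T i).n + 1)))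
  obtain ⟨i, j, hij, hemb⟩ := Forest.wellQuasiOrdered_emb F
  obtain ⟨φ, hl, hφ⟩ := hemb.exists_map (T i).planar (T j).planar (hF i) (hF j)
  simp only [Finset.coe_univ, Set.mem_univ, true_and, forall_const] at hl hφ
  have hz : ∀ z : Fin (S.n + 1) ⊕ (Fin g × Bool),
      φ (z.elim (f i).toFun (T i).mark) = z.elim (f j).toFun (T j).mark := by
    intro z
    have : z ∈ label (f j) (φ (z.elim (f i).toFun (T i).mark)) := by
      rw [hl]
      rfl
    exact this.symm
  refine ⟨i, j, hij, ?_⟩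
  rw [hf i, hf j]
  refine MorClass.divides_mk.2 ⟨⟨φ, fun v w => (hφ v w).1, fun v w => (hφ v w).2, ?_, ?_⟩, ?_⟩
  · have := hz (Sum.inl 0)
    simpa [(f i).root, (f j).root] using this
  · intro v m
    have := hz (Sum.inr m)
    simp only [Sum.elim_inr] at this
    rw [← this]
    exact (hφ _ _).2.symm
  · ext v : 1
    exact hz (Sum.inl v)

theorem isGrobner : IsGrobner (PlanarTree g) where
  essentiallySmall := inferInstance
  g1 := propertyG1
  g2 := propertyG2
  endo _ := endo_eq_id

end PlanarTree

end GraphContraction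

namespace GraphContraction

/-! ### From planar trees to graphs -/

namespace IsPlanar

variable {V : Type*} [LinearOrder V] {anc : V → V → Prop}

theorem ext (h : IsPlanar anc) {a b : V} (hab : ∀ v, anc v a ↔ anc v b) : a = b :=
  le_antisymm (h.le ((hab a).1 (h.refl a))) (h.le ((hab b).2 (h.refl b)))

/-- A non-empty chain closed under ancestors consists of the ancestors of its largest element. This
yields closest ancestors in a subset, parents, and marks of subtrees. -/
theorem exists_top [Finite V] {P : V → Prop} (hne : ∃ v, P v)
    (hdown : ∀ a b, anc a b → P b → P a) (hchain : ∀ a b, P a → P b → a ≤ b → anc a b) :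
    ∃ u, ∀ v, anc v u ↔ P v := by
  obtain ⟨u, hu, hmax⟩ := Set.exists_max_image {v | P v} id (Set.toFinite _) hne
  exact ⟨u, fun v => ⟨fun hv => hdown v u hv hu, fun hv => hchain v u hv hu (hmax v hv)⟩⟩

end IsPlanar

namespace Graph

theorem Adj.symm {G : Graph} {u v : G.V} (h : G.Adj u v) : G.Adj v u := by
  obtain ⟨d, rfl, rfl⟩ := h
  exact ⟨G.rev d, rfl, by rw [G.rev_rev]⟩

/-- A graph is connected if every vertex other than `root` has a neighbour of smaller rank. -/
theorem connected_of_rank (G : Graph) (root : G.V) (rank : G.V → ℕ)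
    (h : ∀ v, v ≠ root → ∃ u, G.Adj v u ∧ rank u < rank v) : G.Connected := by
  have key : ∀ n v, rank v < n → Relation.ReflTransGen G.Adj v root := by
    intro n
    induction n with
    | zero => exact fun v hv => absurd hv (Nat.not_lt_zero _)
    | succ n ih =>
      intro v hv
      by_cases hr : v = root
      · rw [hr]
      · obtain ⟨u, hu, hlt⟩ := h v hr
        exact (ih u (by omega)).head hu
  have : Std.Symm G.Adj := ⟨fun _ _ => Adj.symm⟩
  exact ⟨⟨root⟩, fun u v => (key _ u (Nat.lt_succ_self _)).trans
    (Std.Symm.symm _ _ (key _ v (Nat.lt_succ_self _)))⟩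

end Graph

namespace PlanarTree

variable {g : ℕ}

theorem anc_ext (S : PlanarTree g) {a b : Fin (S.n + 1)} (h : ∀ v, S.anc v a ↔ S.anc v b) :
    a = b :=
  S.planar.ext h

theorem exists_ret {S T : PlanarTree g} (f : S ⟶ T) (w : Fin (T.n + 1)) :
    ∃ u, ∀ v, S.anc v u ↔ T.anc (f.toFun v) w := by
  refine IsPlanar.exists_top ⟨0, by rw [f.root]; exact T.root w⟩
    (fun a b hab hb => T.planar.trans ((f.anc_iff a b).2 hab) hb) fun a b ha hb hab => ?_
  exact (f.anc_iff a b).1 (T.planar.interval (f.strictMono.monotone hab) (T.planar.le hb) ha)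

/-- The closest ancestor of a vertex among the images of the vertices of `S`. -/
noncomputable def ret {S T : PlanarTree g} (f : S ⟶ T) (w : Fin (T.n + 1)) : Fin (S.n + 1) :=
  (exists_ret f w).choose

theorem anc_ret {S T : PlanarTree g} (f : S ⟶ T) (v : Fin (S.n + 1)) (w : Fin (T.n + 1)) :
    S.anc v (ret f w) ↔ T.anc (f.toFun v) w :=
  (exists_ret f w).choose_spec v

theorem ret_toFun {S T : PlanarTree g} (f : S ⟶ T) (v : Fin (S.n + 1)) :
    ret f (f.toFun v) = v :=
  S.anc_ext fun u => by rw [anc_ret, f.anc_iff]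

theorem ret_comp {S T U : PlanarTree g} (f : S ⟶ T) (h : T ⟶ U) (w : Fin (U.n + 1)) :
    ret (f ≫ h) w = ret f (ret h w) :=
  S.anc_ext fun u => by rw [anc_ret, anc_ret, anc_ret, comp_toFun]

theorem ret_id {S : PlanarTree g} (w : Fin (S.n + 1)) : ret (𝟙 S) w = w :=
  ret_toFun (𝟙 S) w

theorem ret_mark {S T : PlanarTree g} (f : S ⟶ T) (m : Fin g × Bool) :
    ret f (T.mark m) = S.mark m :=
  S.anc_ext fun u => by rw [anc_ret, f.mark]

theorem toFun_ret_le {S T : PlanarTree g} (f : S ⟶ T) (w : Fin (T.n + 1)) :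
    f.toFun (ret f w) ≤ w :=
  T.planar.le ((anc_ret f _ w).1 (S.planar.refl _))

theorem exists_par (S : PlanarTree g) (v : Fin (S.n + 1)) (hv : v ≠ 0) :
    ∃ u, ∀ w, S.anc w u ↔ S.anc w v ∧ w ≠ v := by
  refine IsPlanar.exists_top ⟨0, S.root v, hv.symm⟩ (fun a b hab hb => ⟨?_, ?_⟩)
    fun a b ha hb hab => S.planar.interval hab (S.planar.le hb.1) ha.1
  · exact S.planar.trans hab hb.1
  · rintro rfl
    exact hb.2 (le_antisymm (S.planar.le hb.1) (S.planar.le hab))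

/-- The parent of a vertex; by convention the root is its own parent. -/
noncomputable def par (S : PlanarTree g) (v : Fin (S.n + 1)) : Fin (S.n + 1) :=
  if hv : v = 0 then 0 else (S.exists_par v hv).choose

theorem anc_par (S : PlanarTree g) {v : Fin (S.n + 1)} (hv : v ≠ 0) (w : Fin (S.n + 1)) :
    S.anc w (S.par v) ↔ S.anc w v ∧ w ≠ v := by
  rw [par, dif_neg hv]
  exact (S.exists_par v hv).choose_spec w

theorem par_lt (S : PlanarTree g) {v : Fin (S.n + 1)} (hv : v ≠ 0) : S.par v < v := by
  obtain ⟨h1, h2⟩ := (S.anc_par hv (S.par v)).1 (S.planar.refl _)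
  exact lt_of_le_of_ne (S.planar.le h1) h2

/-- As `w` is not in the image of `f`, its ancestors there are those of its parent. Hence the edge
above `w` can be contracted. -/
theorem ret_par {S T : PlanarTree g} (f : S ⟶ T) {w : Fin (T.n + 1)}
    (hw : f.toFun (ret f w) ≠ w) : ret f (T.par w) = ret f w := by
  have hw0 : w ≠ 0 := by
    rintro rfl
    exact hw (le_antisymm (toFun_ret_le f 0) (Fin.zero_le _))
  refine S.anc_ext fun v => ?_
  rw [anc_ret, anc_ret, anc_par _ hw0, and_iff_left_iff_imp]
  rintro - rfl
  rw [ret_toFun] at hw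
  exact hw rfl

/-- The proper ancestors of `f.toFun v` in the image of `f` are the images of those of `v`. Hence
the edge above `f.toFun v` can be sent to the edge above `v`. -/
theorem ret_par_toFun {S T : PlanarTree g} (f : S ⟶ T) {v : Fin (S.n + 1)} (hv : v ≠ 0) :
    ret f (T.par (f.toFun v)) = S.par v := by
  have hw0 : f.toFun v ≠ 0 := fun h => hv (f.injective (h.trans f.root.symm))
  refine S.anc_ext fun u => ?_
  rw [anc_ret, anc_par _ hw0, anc_par _ hv, f.anc_iff, f.injective.ne_iff]

/-- The graph of a planar tree with marked vertices: the edges are those of the tree, which join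
the vertices other than the root to their parents, and for each pair of marked vertices an edge
joining them. -/
noncomputable def toGraph (S : PlanarTree g) : Graph where
  V := Fin (S.n + 1)
  D := ({v : Fin (S.n + 1) // v ≠ 0} ⊕ Fin g) × Bool
  finV := inferInstance
  finD := inferInstance
  src d := d.1.elim (fun v => if d.2 then S.par v.1 else v.1) fun m => S.mark (m, d.2)
  rev d := (d.1, !d.2)
  rev_rev d := by simp
  rev_ne d h := by simpa using congrArg Prod.snd h

theorem connected_toGraph (S : PlanarTree g) : S.toGraph.Connected :=
  S.toGraph.connected_of_rank (0 : Fin (S.n + 1)) (fun v : Fin (S.n + 1) => (v : ℕ))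
    fun v hv => ⟨S.par v, ⟨(Sum.inl ⟨v, hv⟩, false), rfl, rfl⟩, S.par_lt hv⟩

theorem hasGenus_toGraph (S : PlanarTree g) : S.toGraph.HasGenus g := by
  refine ⟨S.connected_toGraph, ?_⟩
  have hD := S.toGraph.card_D
  have h1 : Nat.card S.toGraph.D = (S.n + g) * 2 := by
    change Nat.card (({v : Fin (S.n + 1) // v ≠ 0} ⊕ Fin g) × Bool) = _
    simp [Nat.card_eq_fintype_card, Fintype.card_subtype_compl]
  have hV : S.toGraph.numVertices = S.n + 1 := Nat.card_fin _
  rw [hV]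
  push_cast
  omega

/-- The contraction that corresponds to a morphism of planar trees. -/
noncomputable def graphHom {S T : PlanarTree g} (f : S ⟶ T) : Graph.Hom T.toGraph S.toGraph where
  onV := ret f
  onD d := d.1.elim
    (fun w => if hw : f.toFun (ret f w.1) = w.1 then
        Sum.inr (Sum.inl ⟨ret f w.1, fun h => w.2 (by rw [← hw, h, f.root])⟩, d.2)
      else Sum.inl (ret f w.1))
    fun m => Sum.inr (Sum.inr m, d.2)
  onD_rev := by
    rintro ⟨⟨w, hw⟩ | m, b⟩
    · by_cases h : f.toFun (ret f w) = w
      · simp [toGraph, h]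
      · simp [toGraph, h]
    · rfl
  onV_src := by
    rintro ⟨⟨w, hw⟩ | m, b⟩
    · by_cases h : f.toFun (ret f w) = w
      · have h0 : ret f w ≠ 0 := fun h' => hw (by rw [← h, h', f.root])
        cases b
        · simp [toGraph, h]
        · have := ret_par_toFun f h0
          rw [h] at this
          simp [toGraph, h, this]
      · cases b
        · simp [toGraph, h]
        · simp [toGraph, h, ret_par f h]
    · exact ret_mark f (m, b)

section

variable {S T : PlanarTree g} (f : S ⟶ T)

theorem graphHom_onD_toFun {v : Fin (S.n + 1)} (hv : v ≠ 0) (hv' : f.toFun v ≠ 0) (b : Bool) :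
    (graphHom f).onD (Sum.inl ⟨f.toFun v, hv'⟩, b) = Sum.inr (Sum.inl ⟨v, hv⟩, b) := by
  have h : f.toFun (ret f (f.toFun v)) = f.toFun v := by rw [ret_toFun]
  refine (dif_pos h).trans ?_
  simp only [ret_toFun]
  rfl

theorem graphHom_onD_of_ne {w : Fin (T.n + 1)} (hw : w ≠ 0) (h : f.toFun (ret f w) ≠ w)
    (b : Bool) : (graphHom f).onD (Sum.inl ⟨w, hw⟩, b) = Sum.inl (ret f w) :=
  dif_neg h

theorem toFun_ne_zero {v : Fin (S.n + 1)} (hv : v ≠ 0) : f.toFun v ≠ 0 :=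
  fun h => hv (f.injective (h.trans f.root.symm))

/-- Over `v` lie `f.toFun v` and the other vertices that retract to `v`. Each of the latter
contributes just its edge to its parent, which again lies over `v`, so the fiber is connected with
one edge fewer than vertices. -/
theorem isContraction_graphHom : (graphHom f).IsContraction where
  edge := by
    have key : ∀ (w : Fin (T.n + 1)) (hw : w ≠ 0) (b : Bool) (v : Fin (S.n + 1)) (hv : v ≠ 0)
        (c : Bool), (graphHom f).onD (Sum.inl ⟨w, hw⟩, b) = Sum.inr (Sum.inl ⟨v, hv⟩, c) →
        w = f.toFun v ∧ b = c := by
      intro w hw b v hv c h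
      by_cases hr : f.toFun (ret f w) = w
      · have h0 : ret f w ≠ 0 := fun h' => hw (by rw [← hr, h', f.root])
        have h1 := graphHom_onD_toFun f h0 (toFun_ne_zero f h0) b
        simp only [hr] at h1
        rw [h1] at h
        have h2 : ((Sum.inl ⟨ret f w, h0⟩ : {v : Fin (S.n + 1) // v ≠ 0} ⊕ Fin g), b) =
          (Sum.inl ⟨v, hv⟩, c) := Sum.inr_injective h
        simp only [Prod.mk.injEq, Sum.inl.injEq, Subtype.mk.injEq] at h2
        exact ⟨by rw [← h2.1, hr], h2.2⟩
      · rw [graphHom_onD_of_ne f hw hr] at h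
        cases h
    rintro ⟨⟨v, hv⟩ | m, c⟩
    · refine ⟨(Sum.inl ⟨f.toFun v, toFun_ne_zero f hv⟩, c), graphHom_onD_toFun f hv _ c, ?_⟩
      rintro ⟨⟨w, hw⟩ | m, b⟩ h
      · obtain ⟨rfl, rfl⟩ := key w hw b v hv c h
        rfl
      · cases h
    · refine ⟨(Sum.inr m, c), rfl, ?_⟩
      rintro ⟨⟨w, hw⟩ | m', b⟩ h
      · by_cases hr : f.toFun (ret f w) = w
        · have h0 : ret f w ≠ 0 := fun h' => hw (by rw [← hr, h', f.root])
          have h1 := graphHom_onD_toFun f h0 (toFun_ne_zero f h0) b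
          simp only [hr] at h1
          cases h1.symm.trans h
        · cases (graphHom_onD_of_ne f hw hr b).symm.trans h
      · cases h
        rfl
  vertex := by
    intro v
    change Fin (S.n + 1) at v
    rw [Graph.isContractible_iff]
    let P : Fin (T.n + 1) → Prop := fun w => ret f w = v ∧ w ≠ f.toFun v
    have hP : ∀ w, P w → w ≠ 0 ∧ f.toFun (ret f w) ≠ w := fun w hw => by
      have h1 : f.toFun (ret f w) ≠ w := by
        rw [hw.1]
        exact hw.2.symm
      refine ⟨?_, h1⟩
      rintro rfl
      exact h1 (le_antisymm (toFun_ret_le f 0) (Fin.zero_le _))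
    have hD : ∀ w (hw : P w) b, (graphHom f).onD (Sum.inl ⟨w, (hP w hw).1⟩, b) = Sum.inl v :=
      fun w hw b => (graphHom_onD_of_ne f _ (hP w hw).2 b).trans (congrArg Sum.inl hw.1)
    constructor
    · refine Graph.connected_of_rank _ (⟨f.toFun v, ret_toFun f v⟩ : {a // ret f a = v})
        (fun w : {a // ret f a = v} => (w.1 : ℕ)) ?_
      rintro ⟨w, hw⟩ hne
      have hw' : P w := ⟨hw, fun h => hne (Subtype.ext h)⟩
      exact ⟨⟨T.par w, (ret_par f (hP w hw').2).trans hw⟩,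
        ⟨⟨(Sum.inl ⟨w, (hP w hw').1⟩, false), hD w hw' false⟩, rfl, rfl⟩, T.par_lt (hP w hw').1⟩
    · let eD : {w // P w} × Bool → ((graphHom f).fiber v).D := fun p =>
        ⟨(Sum.inl ⟨p.1.1, (hP p.1.1 p.1.2).1⟩, p.2), hD p.1.1 p.1.2 p.2⟩
      have heD : Function.Bijective eD := by
        constructor
        · rintro ⟨⟨w, hw⟩, b⟩ ⟨⟨w', hw'⟩, b'⟩ h
          cases congrArg Subtype.val h
          rfl
        · rintro ⟨⟨⟨w, hw⟩ | m, b⟩, h⟩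
          · by_cases hr : f.toFun (ret f w) = w
            · have h0 : ret f w ≠ 0 := fun h' => hw (by rw [← hr, h', f.root])
              have h1 := graphHom_onD_toFun f h0 (toFun_ne_zero f h0) b
              simp only [hr] at h1
              cases h1.symm.trans h
            · have hv : ret f w = v :=
                Sum.inl_injective ((graphHom_onD_of_ne f hw hr b).symm.trans h)
              exact ⟨⟨⟨w, hv, fun e => hr (by rw [hv, e])⟩, b⟩, rfl⟩
          · cases h
      let eV : Option {w // P w} → ((graphHom f).fiber v).V := fun o =>
        o.elim ⟨f.toFun v, ret_toFun f v⟩ fun w => ⟨w.1, w.2.1⟩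
      have heV : Function.Bijective eV := by
        constructor
        · rintro (_ | ⟨w, hw⟩) (_ | ⟨w', hw'⟩) h
          · rfl
          · exact absurd (congrArg Subtype.val h).symm hw'.2
          · exact absurd (congrArg Subtype.val h) hw.2
          · have : w = w' := congrArg Subtype.val h
            subst this
            rfl
        · rintro ⟨w, hw⟩
          by_cases h : w = f.toFun v
          · exact ⟨none, Subtype.ext h.symm⟩
          · exact ⟨some ⟨w, hw, h⟩, rfl⟩
      rw [← Nat.card_congr (Equiv.ofBijective eD heD), ← Nat.card_congr (Equiv.ofBijective eV heV),
        Nat.card_prod, Finite.card_option]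
      simp only [Nat.card_eq_fintype_card, Fintype.card_bool]
      omega

end

theorem graphHom_id (S : PlanarTree g) : graphHom (𝟙 S) = Graph.Hom.id S.toGraph := by
  refine Graph.Hom.ext (funext ret_id) (funext ?_)
  rintro ⟨⟨w, hw⟩ | m, b⟩
  · exact graphHom_onD_toFun (𝟙 S) hw hw b
  · rfl

theorem graphHom_comp {S T U : PlanarTree g} (f : S ⟶ T) (h : T ⟶ U) :
    graphHom (f ≫ h) = (graphHom h).comp (graphHom f) := by
  refine Graph.Hom.ext (funext (ret_comp f h)) (funext ?_)
  rintro ⟨⟨w, hw⟩ | m, b⟩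
  · change _ = ((graphHom h).onD _).elim _ _
    by_cases hr : h.toFun (ret h w) = w
    · obtain ⟨u, rfl⟩ : ∃ u, h.toFun u = w := ⟨_, hr⟩
      have hu : u ≠ 0 := by
        rintro rfl
        exact hw h.root
      rw [graphHom_onD_toFun h hu]
      change _ = (graphHom f).onD (Sum.inl ⟨u, hu⟩, b)
      by_cases hs : f.toFun (ret f u) = u
      · obtain ⟨v, rfl⟩ : ∃ v, f.toFun v = u := ⟨_, hs⟩
        have hv : v ≠ 0 := by
          rintro rfl
          exact hu f.root
        rw [graphHom_onD_toFun f hv]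
        exact graphHom_onD_toFun (f ≫ h) hv hw b
      · rw [graphHom_onD_of_ne f hu hs, graphHom_onD_of_ne (f ≫ h) hw, ret_comp, ret_toFun]
        rw [ret_comp, ret_toFun, comp_toFun]
        exact fun e => hs (h.injective e)
    · rw [graphHom_onD_of_ne h hw hr, graphHom_onD_of_ne (f ≫ h) hw, ret_comp]
      · rfl
      · intro e
        rw [comp_toFun] at e
        exact hr (by rw [← e, ret_toFun])
  · rfl

/-- The functor that takes a planar tree with marked vertices to its graph. -/
noncomputable def graphFunctor (g : ℕ) : PlanarTree g ⥤ (GenusGraph g)ᵒᵖ where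
  obj S := Opposite.op ⟨S.toGraph, S.hasGenus_toGraph⟩
  map f := Quiver.Hom.op ⟨graphHom f, isContraction_graphHom f⟩
  map_id S := congrArg Quiver.Hom.op (Subtype.ext (graphHom_id S))
  map_comp f h := congrArg Quiver.Hom.op (Subtype.ext (graphHom_comp f h))

end PlanarTree

end GraphContraction

/-! ### Property (F): factoring contractions of graphs of planar trees -/

namespace GraphContraction

namespace Graph.Hom

theorem comp_onD {G G' G'' : Graph} (φ : Hom G G') (ψ : Hom G' G'') (d : G.D) :
    (φ.comp ψ).onD d = (φ.onD d).elim (fun x => Sum.inl (ψ.onV x)) ψ.onD := rfl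

/-- The fibers of `ψ` are images of the connected fibers of the composite. Since the fibers of `φ`
are trees, passing to the image does not change the Euler characteristic. -/
theorem IsContraction.of_comp {G G' G'' : Graph} {φ : Hom G G'} {ψ : Hom G' G''}
    (hφ : φ.IsContraction) (h : (φ.comp ψ).IsContraction) : ψ.IsContraction where
  edge := by
    intro d''
    obtain ⟨d, hd, hu⟩ := h.edge d''
    have hlift : ∀ c', ψ.onD c' = Sum.inr d'' → φ.onD d = Sum.inr c' := by
      intro c' hc'
      obtain ⟨c, hc, -⟩ := hφ.edge c'
      have : (φ.comp ψ).onD c = Sum.inr d'' := by rw [comp_onD, hc]; exact hc'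
      rw [← hu c this]
      exact hc
    rcases hx : φ.onD d with x | d'
    · rw [comp_onD, hx] at hd
      cases hd
    · refine ⟨d', ?_, fun c' hc' => ?_⟩
      · rw [comp_onD, hx] at hd
        exact hd
      · exact Sum.inr_injective ((hlift c' hc').symm.trans hx)
  vertex := by
    classical
    intro w
    obtain ⟨⟨⟨a₀⟩, hFc⟩, hFn⟩ := (isContractible_iff _).1 (h.vertex w)
    have hv := fun x => (isContractible_iff _).1 (hφ.vertex x)
    rw [isContractible_iff]
    set F := (φ.comp ψ).fiber w with hF
    let π : F.V → (ψ.fiber w).V := fun a => ⟨φ.onV a.1, a.2⟩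
    have hπ : Function.Surjective π := by
      rintro ⟨x, hx⟩
      obtain ⟨a⟩ := (hv x).1.1
      exact ⟨⟨a.1, (congrArg ψ.onV a.2).trans hx⟩, Subtype.ext a.2⟩
    have hstep : ∀ a b : F.V, F.Adj a b → Relation.ReflTransGen (ψ.fiber w).Adj (π a) (π b) := by
      rintro a b ⟨d, rfl, rfl⟩
      have hd := d.2
      rw [comp_onD] at hd
      rcases hx : φ.onD d.1 with x | d'
      · have e1 : φ.onV (G.src d.1) = x := by rw [φ.onV_src, hx]; rfl
        have e2 : φ.onV (G.src (G.rev d.1)) = x := by rw [φ.onV_src, φ.onD_rev, hx]; rfl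
        have : π (F.src d) = π (F.src (F.rev d)) := Subtype.ext (e1.trans e2.symm)
        rw [this]
      · rw [hx] at hd
        have e1 : φ.onV (G.src d.1) = G'.src d' := by rw [φ.onV_src, hx]; rfl
        have e2 : φ.onV (G.src (G.rev d.1)) = G'.src (G'.rev d') := by
          rw [φ.onV_src, φ.onD_rev, hx]; rfl
        exact .single ⟨⟨d', hd⟩, Subtype.ext e1.symm, Subtype.ext e2.symm⟩
    refine ⟨⟨⟨π a₀⟩, fun x y => ?_⟩, ?_⟩
    · obtain ⟨a, rfl⟩ := hπ x
      obtain ⟨b, rfl⟩ := hπ y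
      induction hFc a b with
      | refl => exact .refl
      | tail _ hbc ih => exact ih.trans (hstep _ _ hbc)
    · have eV : F.V ≃ Σ y : (ψ.fiber w).V, (φ.fiber y.1).V :=
        { toFun := fun a => ⟨⟨φ.onV a.1, a.2⟩, ⟨a.1, rfl⟩⟩
          invFun := fun p => ⟨p.2.1, (congrArg ψ.onV p.2.2).trans p.1.2⟩
          left_inv := fun _ => rfl
          right_inv := by
            rintro ⟨⟨y, hy⟩, ⟨a, ha⟩⟩
            change φ.onV a = y at ha
            subst ha
            rfl }
      let fD : ((Σ y : (ψ.fiber w).V, (φ.fiber y.1).D) ⊕ (ψ.fiber w).D) → F.D := fun p =>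
        p.elim
          (fun q => ⟨q.2.1, by rw [comp_onD, q.2.2]; exact congrArg Sum.inl q.1.2⟩)
          (fun d' => ⟨(hφ.edge d'.1).choose, by
            rw [comp_onD, (hφ.edge d'.1).choose_spec.1]; exact d'.2⟩)
      have hfD : Function.Bijective fD := by
        constructor
        · rintro (⟨⟨y, hy⟩, ⟨d, hd⟩⟩ | d) (⟨⟨y', hy'⟩, ⟨d', hd'⟩⟩ | d') h
          · have h' : d = d' := congrArg Subtype.val h
            subst h'
            have : y = y' := Sum.inl_injective (hd.symm.trans hd')
            subst this
            rfl
          · have h' : d = (hφ.edge d'.1).choose := congrArg Subtype.val h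
            have := (hφ.edge d'.1).choose_spec.1
            rw [← h'] at this
            cases hd.symm.trans this
          · have h' : (hφ.edge d.1).choose = d' := congrArg Subtype.val h
            have := (hφ.edge d.1).choose_spec.1
            rw [h'] at this
            cases hd'.symm.trans this
          · have h' : (hφ.edge d.1).choose = (hφ.edge d'.1).choose := congrArg Subtype.val h
            have h1 := (hφ.edge d.1).choose_spec.1
            have h2 := (hφ.edge d'.1).choose_spec.1
            simp only at h1 h2
            rw [h', h2] at h1
            exact congrArg Sum.inr (Subtype.ext (Sum.inr_injective h1).symm)
        · rintro ⟨d, hd⟩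
          rw [comp_onD] at hd
          rcases hc : φ.onD d with x | d'
          · rw [hc] at hd
            exact ⟨Sum.inl ⟨⟨x, Sum.inl_injective hd⟩, ⟨d, hc⟩⟩, rfl⟩
          · rw [hc] at hd
            refine ⟨Sum.inr ⟨d', hd⟩, Subtype.ext ?_⟩
            exact ((hφ.edge d').choose_spec.2 d hc).symm
      have := Fintype.ofFinite (ψ.fiber w).V
      rw [Nat.card_congr eV, ← Nat.card_congr (Equiv.ofBijective fD hfD), Nat.card_sum,
        Nat.card_sigma, Nat.card_sigma, Finset.mul_sum,
        ← Finset.sum_congr rfl (fun (y : (ψ.fiber w).V) _ => (hv y.1).2),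
        Finset.sum_add_distrib] at hFn
      simp only [Finset.sum_const, Finset.card_univ, smul_eq_mul,
        ← Nat.card_eq_fintype_card] at hFn
      omega

end Graph.Hom

namespace PlanarTree

variable {g : ℕ}

/-- Every set of vertices that contains the root is the set of vertices of a tree. -/
theorem exists_hom_range (T : PlanarTree g) (R : Finset (Fin (T.n + 1))) (h0 : 0 ∈ R) :
    ∃ (S : PlanarTree g) (f : S ⟶ T), Set.range f.toFun = R := by
  have hcard : R.card = R.card - 1 + 1 := by
    have := Finset.card_pos.2 ⟨0, h0⟩
    omega
  set e := R.orderEmbOfFin hcard with he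
  have hrange : Set.range e = R := R.range_orderEmbOfFin hcard
  have hz : e 0 = 0 := by
    obtain ⟨i, hi⟩ : (0 : Fin (T.n + 1)) ∈ Set.range e := by rw [hrange]; exact h0
    refine le_antisymm ?_ (Fin.zero_le _)
    rw [← hi]
    exact e.monotone (Fin.zero_le _)
  have hp : IsPlanar fun v w => T.anc (e v) (e w) :=
    { refl := fun a => T.planar.refl _
      le := fun h => e.le_iff_le.1 (T.planar.le h)
      trans := T.planar.trans
      interval := fun h h' => T.planar.interval (e.monotone h) (e.monotone h') }
  have hroot : ∀ v, T.anc (e 0) (e v) := fun v => by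
    rw [hz]
    exact T.root _
  have hmark : ∀ m, ∃ u, ∀ v, T.anc (e v) (e u) ↔ T.anc (e v) (T.mark m) := fun m =>
    IsPlanar.exists_top (anc := fun v w => T.anc (e v) (e w)) ⟨0, by rw [hz]; exact T.root _⟩
      (fun a b hab hb => T.planar.trans hab hb)
      fun a b ha hb hab => T.planar.interval (e.monotone hab) (T.planar.le hb) ha
  choose p hp' using hmark
  exact ⟨⟨R.card - 1, fun v w => T.anc (e v) (e w), hp, hroot, p⟩,
    ⟨e, e.strictMono, fun _ _ => Iff.rfl, hz, fun v m => hp' m v⟩, hrange⟩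

/-- On the way up from `w` to its closest ancestor in the image of `f`, every edge is contracted by
`φ`, so its two ends have the same image. -/
theorem ret_onV_eq {S T : PlanarTree g} (f : S ⟶ T) {G : Graph} (φ : Graph.Hom T.toGraph G)
    (h : ∀ (w : Fin (T.n + 1)) (hw : w ≠ 0), f.toFun (ret f w) ≠ w →
      ∃ x, φ.onD (Sum.inl ⟨w, hw⟩, false) = Sum.inl x)
    (w : Fin (T.n + 1)) : φ.onV (f.toFun (ret f w)) = φ.onV w := by
  induction w using WellFoundedLT.induction with
  | _ w ih =>
  by_cases hr : f.toFun (ret f w) = w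
  · rw [hr]
  · have hw : w ≠ 0 := by
      rintro rfl
      exact hr (le_antisymm (toFun_ret_le f 0) (Fin.zero_le _))
    obtain ⟨x, hx⟩ := h w hw hr
    have e1 : φ.onV w = x := by
      have := φ.onV_src (Sum.inl ⟨w, hw⟩, false)
      rw [hx] at this
      exact this
    have e2 : φ.onV (T.par w) = x := by
      let d : T.toGraph.D := (Sum.inl ⟨w, hw⟩, false)
      have := φ.onV_src (T.toGraph.rev d)
      rw [φ.onD_rev, show φ.onD d = Sum.inl x from hx] at this
      exact this
    have := ih _ (T.par_lt hw)
    rw [ret_par f hr] at this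
    rw [this, e1, e2]

/-- If a morphism to `G` contracts all tree edges of `T` other than those of `S`, then it factors
through the graph of `S`. -/
theorem exists_factor {S T : PlanarTree g} (f : S ⟶ T) {G : Graph} (φ : Graph.Hom T.toGraph G)
    (h : ∀ (w : Fin (T.n + 1)) (hw : w ≠ 0), f.toFun (ret f w) ≠ w →
      ∃ x, φ.onD (Sum.inl ⟨w, hw⟩, false) = Sum.inl x) :
    ∃ ψ : Graph.Hom S.toGraph G, (graphHom f).comp ψ = φ := by
  -- A section of `graphHom f` on oriented edges; the factor `ψ` is `φ` read along it.
  let ι : S.toGraph.D → T.toGraph.D := fun d =>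
    (d.1.map (fun v => ⟨f.toFun v.1, toFun_ne_zero f v.2⟩) id, d.2)
  have hι : ∀ d, ret f (T.toGraph.src (ι d)) = S.toGraph.src d := by
    rintro ⟨⟨v, hv⟩ | m, b⟩
    · cases b
      · exact ret_toFun f v
      · exact ret_par_toFun f hv
    · exact ret_mark f (m, b)
  refine ⟨⟨fun v => φ.onV (f.toFun v), fun d => φ.onD (ι d), fun d => φ.onD_rev (ι d),
    fun d => ?_⟩, ?_⟩
  · rw [← φ.onV_src, ← ret_onV_eq f φ h (T.toGraph.src (ι d)), hι]
  · refine Graph.Hom.ext (funext (ret_onV_eq f φ h)) (funext ?_)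
    rintro ⟨⟨w, hw⟩ | m, b⟩
    · change ((graphHom f).onD (Sum.inl ⟨w, hw⟩, b)).elim
        (fun x => Sum.inl (φ.onV (f.toFun x))) (fun d => φ.onD (ι d)) = _
      by_cases hr : f.toFun (ret f w) = w
      · obtain ⟨u, rfl⟩ : ∃ u, f.toFun u = w := ⟨_, hr⟩
        have hu : u ≠ 0 := by
          rintro rfl
          exact hw f.root
        rw [graphHom_onD_toFun f hu]
        rfl
      · rw [graphHom_onD_of_ne f hw hr]
        obtain ⟨x, hx⟩ := h w hw hr
        have e : φ.onV w = x := by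
          have := φ.onV_src (Sum.inl ⟨w, hw⟩, false)
          rw [hx] at this
          exact this
        have hb : φ.onD (Sum.inl ⟨w, hw⟩, b) = Sum.inl x := by
          cases b
          · exact hx
          · have := φ.onD_rev (Sum.inl ⟨w, hw⟩, false)
            rw [hx] at this
            exact this
        rw [hb, ← e]
        exact congrArg Sum.inl (ret_onV_eq f φ h w)
    · rfl

/-- `S` keeps the root and the vertices whose edge to the parent survives under `φ`; `ψ` may still
contract marked edges. The bound on `S.n` does not depend on `T`, which is the finiteness in
property (F). -/
theorem exists_small_factor (T : PlanarTree g) {G : Graph} (φ : Graph.Hom T.toGraph G)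
    (hφ : φ.IsContraction) : ∃ (S : PlanarTree g) (f : S ⟶ T) (ψ : Graph.Hom S.toGraph G),
      S.n ≤ Nat.card G.D ∧ ψ.IsContraction ∧ (graphHom f).comp ψ = φ := by
  classical
  obtain ⟨S, f, hf⟩ := T.exists_hom_range
    (Finset.univ.filter fun w => ∀ hw : w ≠ 0, ∃ d, φ.onD (Sum.inl ⟨w, hw⟩, false) = Sum.inr d)
    (by simp)
  have hmem : ∀ w, w ∈ Set.range f.toFun ↔
      ∀ hw : w ≠ 0, ∃ d, φ.onD (Sum.inl ⟨w, hw⟩, false) = Sum.inr d := by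
    intro w
    rw [hf]
    simp
  obtain ⟨ψ, hψ⟩ := exists_factor f φ fun w hw hr => by
    rcases hx : φ.onD (Sum.inl ⟨w, hw⟩, false) with x | d
    · exact ⟨x, rfl⟩
    · obtain ⟨v, rfl⟩ := (hmem w).2 fun _ => ⟨d, hx⟩
      exact absurd (by rw [ret_toFun]) hr
  refine ⟨S, f, ψ, ?_, (isContraction_graphHom f).of_comp (hψ ▸ hφ), hψ⟩
  have hex : ∀ v : {v : Fin (S.n + 1) // v ≠ 0},
      ∃ d, φ.onD (Sum.inl ⟨f.toFun v.1, toFun_ne_zero f v.2⟩, false) = Sum.inr d := fun v =>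
    (hmem _).1 ⟨v.1, rfl⟩ (toFun_ne_zero f v.2)
  choose δ hδ using hex
  have hinj : Function.Injective δ := by
    intro v v' e
    obtain ⟨d, -, hu⟩ := hφ.edge (δ v)
    have e' := (hu _ (hδ v)).trans (hu _ ((hδ v').trans (congrArg Sum.inr e.symm))).symm
    have e'' : f.toFun v.1 = f.toFun v'.1 :=
      congrArg Subtype.val (Sum.inl_injective (congrArg Prod.fst e'))
    exact Subtype.ext (f.injective e'')
  have := Nat.card_le_card_of_injective δ hinj
  rwa [Nat.card_eq_fintype_card, Fintype.card_subtype_compl, Fintype.card_fin,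
    Fintype.card_subtype_eq, Nat.add_sub_cancel] at this

instance (G G' : GenusGraph g) : Finite (G ⟶ G') := by
  have : Finite (Graph.Hom G.graph G'.graph) :=
    Finite.of_injective (fun φ => (φ.onV, φ.onD)) fun φ ψ h =>
      Graph.Hom.ext (congrArg Prod.fst h) (congrArg Prod.snd h)
  exact inferInstanceAs (Finite {φ : Graph.Hom G.graph G'.graph // φ.IsContraction})

theorem propertyF_graphFunctor : PropertyF (graphFunctor g) := by
  intro G
  have := finite_le (g := g) (Nat.card G.unop.graph.D)
  let A := Σ S : {S : PlanarTree g // S.n ≤ Nat.card G.unop.graph.D},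
    ((⟨S.1.toGraph, S.1.hasGenus_toGraph⟩ : GenusGraph g) ⟶ G.unop)
  obtain ⟨r, ⟨e⟩⟩ := Finite.exists_equiv_fin A
  refine ⟨r, fun i => (e.symm i).1.1, fun i => (e.symm i).2.op, fun T h => ?_⟩
  obtain ⟨S, f, ψ, hS, hψ, hcomp⟩ := T.exists_small_factor h.unop.1 h.unop.2
  obtain ⟨i, hi⟩ := e.symm.surjective ⟨⟨S, hS⟩, ⟨ψ, hψ⟩⟩
  suffices ∀ p : A, p = ⟨⟨S, hS⟩, ⟨ψ, hψ⟩⟩ → ∃ e : p.1.1 ⟶ T,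
      h = (show G ⟶ (graphFunctor g).obj p.1.1 from p.2.op) ≫ (graphFunctor g).map e from
    ⟨i, this _ hi⟩
  rintro _ rfl
  exact ⟨f, Quiver.Hom.unop_inj (Subtype.ext hcomp.symm)⟩

end PlanarTree

end GraphContraction

namespace GraphContraction

/-! ### Every connected graph comes from a planar tree -/

theorem cons_le_cons_iff_of_linearOrder {α : Type*} [LinearOrder α] {x y : α} {a b : List α} :
    x :: a ≤ y :: b ↔ x < y ∨ x = y ∧ a ≤ b := by
  rw [← not_lt, List.cons_lt_cons_iff, ← not_lt]
  rcases lt_trichotomy x y with h | rfl | h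
  · simp [h, h.not_gt, h.ne']
  · simp
  · simp [h, h.not_gt, h.ne']

/-- Words with a given prefix form an interval in the lexicographic order. This supplies the
`interval` axiom of planar trees. -/
theorem isPrefix_of_le_of_le {α : Type*} [LinearOrder α] {a b c : List α} (hab : a ≤ b)
    (hbc : b ≤ c) (hac : a <+: c) : a <+: b := by
  induction a generalizing b c with
  | nil => exact List.nil_prefix
  | cons x a ih =>
    rcases c with _ | ⟨z, c⟩
    · simp at hac
    rcases b with _ | ⟨y, b⟩
    · exact absurd hab (not_le.2 (List.nil_lt_cons _ _))
    obtain ⟨rfl, hac'⟩ := List.cons_prefix_cons.1 hac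
    rw [cons_le_cons_iff_of_linearOrder] at hab hbc
    have hxy : x = y := by
      rcases hab with h | h <;> rcases hbc with h' | h'
      · exact absurd (h.trans h') (lt_irrefl _)
      · exact h'.1.symm
      · exact h.1
      · exact h.1
    subst hxy
    simp only [lt_irrefl, false_or, true_and] at hab hbc
    exact List.cons_prefix_cons.2 ⟨rfl, ih hab hbc hac'⟩

theorem le_of_isPrefix {α : Type*} [LinearOrder α] {a b : List α} (h : a <+: b) : a ≤ b := by
  induction a generalizing b with
  | nil => exact not_lt.1 (List.not_lt_nil _)
  | cons x a ih =>
    rcases b with _ | ⟨y, b⟩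
    · simp at h
    obtain ⟨rfl, h'⟩ := List.cons_prefix_cons.1 h
    exact cons_le_cons_iff_of_linearOrder.2 (Or.inr ⟨rfl, ih h'⟩)

theorem isPlanar_isPrefix {V α : Type*} [LinearOrder α] [LinearOrder V] (path : V → List α)
    (h : ∀ v w, v ≤ w ↔ path v ≤ path w) : IsPlanar fun v w => path v <+: path w where
  refl _ := List.prefix_refl _
  le hab := (h _ _).2 (le_of_isPrefix hab)
  trans hab hbc := hab.trans hbc
  interval hab hbc hac := isPrefix_of_le_of_le ((h _ _).1 hab) ((h _ _).1 hbc) hac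

/-- A rooted tree, given by its parent map, has a planar structure. -/
theorem exists_isPlanar {V : Type*} (root : V) (par : V → V) (rank : V → ℕ)
    (h : ∀ v, v ≠ root → rank (par v) < rank v) :
    ∃ (_ : LinearOrder V) (anc : V → V → Prop), IsPlanar anc ∧ (∀ v, anc root v) ∧
      ∀ v, v ≠ root → ∀ w, anc w (par v) ↔ anc w v ∧ w ≠ v := by
  classical
  -- `path v` lists the vertices from the root, excluded, down to `v`. Prefixes are ancestors, and
  -- lexicographic order is depth-first order for an arbitrary order on siblings.
  obtain ⟨path, hpath⟩ : ∃ path : V → List V,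
      ∀ v, path v = if v = root then [] else path (par v) ++ [v] := by
    refine ⟨(measure rank).wf.fix fun v ih =>
      if hv : v = root then [] else ih (par v) (h v hv) ++ [v], fun v => ?_⟩
    rw [WellFounded.fix_eq]
    split_ifs <;> rfl
  have hroot : path root = [] := by rw [hpath, if_pos rfl]
  have hne : ∀ v, v ≠ root → path v = path (par v) ++ [v] := fun v hv => by
    rw [hpath, if_neg hv]
  have hinj : Function.Injective path := by
    intro v w e
    by_cases hv : v = root <;> by_cases hw : w = root
    · rw [hv, hw]
    · rw [hv, hroot, hne w hw] at e
      simp at e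
    · rw [hw, hroot, hne v hv] at e
      simp at e
    · rw [hne v hv, hne w hw] at e
      simpa using (List.append_inj' e rfl).2
  let _ : LinearOrder V := linearOrderOfSTO WellOrderingRel
  refine ⟨LinearOrder.lift' path hinj, fun v w => path v <+: path w, ?_, ?_, ?_⟩
  · exact @isPlanar_isPrefix V V _ (LinearOrder.lift' path hinj) path fun _ _ => Iff.rfl
  · intro v
    rw [hroot]
    exact List.nil_prefix
  · intro v hv w
    change path w <+: path (par v) ↔ path w <+: path v ∧ w ≠ v
    rw [hne v hv, List.prefix_concat_iff, ← hne v hv]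
    constructor
    · intro hw
      refine ⟨Or.inr hw, ?_⟩
      rintro rfl
      rw [hne w hv] at hw
      have := hw.length_le
      simp at this
    · rintro ⟨hw | hw, hwv⟩
      · exact absurd (hinj hw) hwv
      · exact hw

/-- A finite rooted tree with marked vertices is isomorphic to a planar tree. -/
theorem PlanarTree.exists_equiv {g : ℕ} {V : Type} [Finite V] (root : V) (par : V → V)
    (rank : V → ℕ) (h : ∀ v, v ≠ root → rank (par v) < rank v) (mark : Fin g × Bool → V) :
    ∃ (S : PlanarTree g) (e : Fin (S.n + 1) ≃ V), e 0 = root ∧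
      (∀ v, v ≠ 0 → e (S.par v) = par (e v)) ∧ ∀ m, e (S.mark m) = mark m := by
  obtain ⟨_, anc, hp, hr, hpar⟩ := exists_isPlanar root par rank h
  have := Fintype.ofFinite V
  have hcard : Fintype.card V = Fintype.card V - 1 + 1 := by
    have := Fintype.card_pos_iff.2 ⟨root⟩
    omega
  let e := Fintype.orderIsoFinOfCardEq V hcard
  have h0 : e 0 = root := by
    refine le_antisymm ?_ (hp.le (hr _))
    rw [← e.apply_symm_apply root]
    exact e.monotone (Fin.zero_le _)
  let S : PlanarTree g :=
    { n := Fintype.card V - 1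
      anc := fun v w => anc (e v) (e w)
      planar :=
        { refl := fun a => hp.refl _
          le := fun h => e.le_iff_le.1 (hp.le h)
          trans := hp.trans
          interval := fun h h' => hp.interval (e.monotone h) (e.monotone h') }
      root := fun v => by
        rw [h0]
        exact hr _
      mark := fun m => e.symm (mark m) }
  refine ⟨S, e.toEquiv, h0, fun v hv => ?_, fun m => e.apply_symm_apply _⟩
  have hv' : e v ≠ root := fun h => hv (e.injective (h.trans h0.symm))
  refine hp.ext fun w => ?_
  obtain ⟨w, rfl⟩ := e.surjective w
  change anc (e w) (e (S.par v)) ↔ anc (e w) (par (e v))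
  rw [hpar _ hv', e.injective.ne_iff]
  exact S.anc_par hv w

/-! ### Spanning trees, isomorphisms of graphs, and essential surjectivity -/

namespace Graph

/-- The vertex `v` is joined to `root` by an edge path of length `n`. -/
def JoinedIn (G : Graph) (root : G.V) : ℕ → G.V → Prop
  | 0, v => v = root
  | n + 1, v => ∃ u, G.JoinedIn root n u ∧ G.Adj v u

/-- A connected graph has a spanning tree: every vertex `v` other than the root has an edge, here
`δ v`, to a vertex of smaller rank. -/
theorem Connected.exists_spanningTree {G : Graph} (hG : G.Connected) :
    ∃ (root : G.V) (rank : G.V → ℕ) (δ : {v // v ≠ root} → G.D),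
      ∀ v, G.src (δ v) = v.1 ∧ rank (G.src (G.rev (δ v))) < rank v.1 := by
  classical
  obtain ⟨⟨root⟩, hc⟩ := hG
  have hjoin : ∀ v : G.V, ∃ n : ℕ, G.JoinedIn root n v := by
    intro v
    induction hc root v with
    | refl => exact ⟨0, rfl⟩
    | tail _ h ih =>
      obtain ⟨n, hn⟩ := ih
      exact ⟨n + 1, _, hn, h.symm⟩
  -- The distance to the root; `δ v` will be the first edge of a shortest path.
  let rank : G.V → ℕ := fun v => Nat.find (hjoin v)
  have hstep : ∀ v : {v // v ≠ root}, ∃ d : G.D, G.src d = v.1 ∧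
      rank (G.src (G.rev d)) < rank v.1 := by
    rintro ⟨v, hv⟩
    have h := Nat.find_spec (hjoin v)
    change ∃ d : G.D, G.src d = v ∧ Nat.find (hjoin (G.src (G.rev d))) < Nat.find (hjoin v)
    rcases hn : Nat.find (hjoin v) with _ | n
    · rw [hn] at h
      exact absurd h hv
    · rw [hn] at h
      obtain ⟨u, hu, d, hd, rfl⟩ := h
      exact ⟨d, hd, Nat.lt_succ_of_le (Nat.find_min' _ hu)⟩
  choose δ hδ using hstep
  exact ⟨root, rank, δ, hδ⟩

theorem exists_orientation (G : Graph) :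
    ∃ q : G.Edge × Bool ≃ G.D, ∀ e b, q (e, !b) = G.rev (q (e, b)) := by
  let r : G.Edge → G.D := fun e => Quotient.out (s := G.edgeSetoid) e
  let c : G.D → G.Edge := fun d => Quotient.mk G.edgeSetoid d
  have hrc : ∀ d, r (c d) = d ∨ r (c d) = G.rev d := fun d =>
    Quotient.mk_out (s := G.edgeSetoid) d
  let q : G.Edge × Bool → G.D := fun p => if p.2 then r p.1 else G.rev (r p.1)
  have hs : Function.Surjective q := by
    intro d
    rcases hrc d with h | h
    · exact ⟨(c d, true), by simpa [q] using h⟩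
    · exact ⟨(c d, false), by simp [q, h, G.rev_rev]⟩
  have : Finite G.Edge := inferInstanceAs (Finite (Quotient G.edgeSetoid))
  have hb : Function.Bijective q := hs.bijective_of_nat_card_le (by
    rw [Nat.card_prod, G.card_D, numEdges]
    simp [mul_comm])
  refine ⟨Equiv.ofBijective q hb, fun e b => ?_⟩
  cases b <;> simp [q, G.rev_rev]

/-- An isomorphism of graphs as a morphism. -/
def Hom.ofEquiv {G G' : Graph} (eV : G.V ≃ G'.V) (eD : G.D ≃ G'.D)
    (hrev : ∀ d, eD (G.rev d) = G'.rev (eD d)) (hsrc : ∀ d, eV (G.src d) = G'.src (eD d)) :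
    Hom G G' where
  onV := eV
  onD d := Sum.inr (eD d)
  onD_rev d := congrArg Sum.inr (hrev d)
  onV_src := hsrc

theorem Hom.isContraction_ofEquiv {G G' : Graph} (eV : G.V ≃ G'.V) (eD : G.D ≃ G'.D)
    (hrev : ∀ d, eD (G.rev d) = G'.rev (eD d)) (hsrc : ∀ d, eV (G.src d) = G'.src (eD d)) :
    (Hom.ofEquiv eV eD hrev hsrc).IsContraction where
  edge d' := ⟨eD.symm d', congrArg Sum.inr (eD.apply_symm_apply d'), fun d h =>
    (eD.symm_apply_apply d).symm.trans (congrArg eD.symm (Sum.inr_injective h))⟩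
  vertex x := by
    rw [isContractible_iff]
    let a : ((Hom.ofEquiv eV eD hrev hsrc).fiber x).V := ⟨eV.symm x, eV.apply_symm_apply x⟩
    have ha : ∀ b, b = a := fun b => Subtype.ext (eV.injective (b.2.trans a.2.symm))
    have hD : IsEmpty ((Hom.ofEquiv eV eD hrev hsrc).fiber x).D := ⟨fun d => by cases d.2⟩
    rw [Nat.card_eq_one_iff_exists.2 ⟨a, ha⟩, Nat.card_of_isEmpty]
    refine ⟨⟨⟨a⟩, fun b c => ?_⟩, rfl⟩
    rw [ha b, ha c]

end Graph

/-- Isomorphic graphs are isomorphic objects of the contraction category. -/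
def GenusGraph.isoOfEquiv {g : ℕ} {G G' : GenusGraph g} (eV : G.graph.V ≃ G'.graph.V)
    (eD : G.graph.D ≃ G'.graph.D) (hrev : ∀ d, eD (G.graph.rev d) = G'.graph.rev (eD d))
    (hsrc : ∀ d, eV (G.graph.src d) = G'.graph.src (eD d)) : G ≅ G' where
  hom := ⟨.ofEquiv eV eD hrev hsrc, Graph.Hom.isContraction_ofEquiv eV eD hrev hsrc⟩
  inv := ⟨.ofEquiv eV.symm eD.symm
      (fun d => by rw [Equiv.symm_apply_eq, hrev, eD.apply_symm_apply])
      (fun d => by rw [Equiv.symm_apply_eq, hsrc, eD.apply_symm_apply]),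
    Graph.Hom.isContraction_ofEquiv _ _ _ _⟩
  hom_inv_id := Subtype.ext (Graph.Hom.ext (funext eV.symm_apply_apply)
    (funext fun d => congrArg Sum.inr (eD.symm_apply_apply d)))
  inv_hom_id := Subtype.ext (Graph.Hom.ext (funext eV.apply_symm_apply)
    (funext fun d => congrArg Sum.inr (eD.apply_symm_apply d)))

theorem GenusGraph.exists_planarTree {g : ℕ} (G : GenusGraph g) : ∃ S : PlanarTree g,
    Nonempty ((⟨S.toGraph, S.hasGenus_toGraph⟩ : GenusGraph g) ≅ G) := by
  classical
  obtain ⟨H, hH⟩ := G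
  obtain ⟨root, rank, δ, hδ⟩ := hH.1.exists_spanningTree
  -- The oriented edges of the spanning tree; as in `toGraph`, `true` is the orientation that starts
  -- at the parent.
  let τ : {v // v ≠ root} × Bool → H.D := fun p => if p.2 then H.rev (δ p.1) else δ p.1
  have hτrev : ∀ v b, τ (v, !b) = H.rev (τ (v, b)) := by
    rintro v (_ | _) <;> simp [τ, H.rev_rev]
  -- Otherwise one edge would lower the rank in both directions.
  have hrank : ∀ v w, δ v ≠ H.rev (δ w) := by
    intro v w e
    have h1 := (hδ v).2
    have h2 := (hδ w).2
    rw [← e, (hδ v).1] at h2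
    rw [e, H.rev_rev, (hδ w).1] at h1
    omega
  have hτ : Function.Injective τ := by
    have hδinj : Function.Injective δ := fun v w e =>
      Subtype.ext ((hδ v).1.symm.trans ((congrArg H.src e).trans (hδ w).1))
    rintro ⟨v, _ | _⟩ ⟨w, _ | _⟩ e <;> simp only [τ, if_true, Bool.false_eq_true, if_false] at e
    · rw [hδinj e]
    · exact absurd e (hrank v w)
    · exact absurd e.symm (hrank w v)
    · rw [hδinj ((H.rev_rev _).symm.trans ((congrArg H.rev e).trans (H.rev_rev _)))]
  -- The graph of the edges outside the spanning tree. It need not be connected: only the number of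
  -- its edges and an orientation of each are used.
  let K : Graph :=
    { V := H.V
      D := {d // d ∉ Set.range τ}
      finV := inferInstance
      finD := inferInstance
      src := fun d => H.src d.1
      rev := fun d => ⟨H.rev d.1, by
        rintro ⟨⟨v, b⟩, hd⟩
        exact d.2 ⟨(v, !b), by rw [hτrev, hd, H.rev_rev]⟩⟩
      rev_rev := fun d => Subtype.ext (H.rev_rev d.1)
      rev_ne := fun d h => H.rev_ne d.1 (congrArg Subtype.val h) }
  have hK : K.numEdges = g := by
    have h1 := K.card_D
    have h2 := H.card_D
    have h3 : Nat.card H.D = Nat.card ({v // v ≠ root} × Bool) + Nat.card K.D := by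
      rw [Nat.card_congr (Equiv.ofInjective τ hτ), ← Nat.card_sum]
      exact Nat.card_congr (Equiv.sumCompl (· ∈ Set.range τ)).symm
    have h4 : Nat.card {v // v ≠ root} + 1 = Nat.card H.V := by
      rw [← Finite.card_option, Nat.card_congr (Equiv.optionSubtypeNe root)]
    rw [Nat.card_prod, Nat.card_eq_fintype_card (α := Bool), Fintype.card_bool] at h3
    have h5 := hH.2
    unfold Graph.numVertices at h5
    omega
  obtain ⟨q, hq⟩ := K.exists_orientation
  have : Finite K.Edge := inferInstanceAs (Finite (Quotient K.edgeSetoid))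
  let ε : Fin g ≃ K.Edge := (Finite.equivFinOfCardEq hK).symm
  obtain ⟨S, e, he0, hepar, hemark⟩ := PlanarTree.exists_equiv root
    (fun v => if hv : v = root then root else H.src (H.rev (δ ⟨v, hv⟩))) rank
    (fun v hv => by
      rw [dif_neg hv]
      exact (hδ ⟨v, hv⟩).2)
    (fun m : Fin g × Bool => H.src (q (ε m.1, m.2)).1)
  have hene : ∀ v, v ≠ 0 → e v ≠ root := fun v hv h => hv (e.injective (h.trans he0.symm))
  let β : S.toGraph.D → H.D := fun d =>
    d.1.elim (fun v => τ (⟨e v.1, hene v.1 v.2⟩, d.2)) fun m => (q (ε m, d.2)).1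
  have hβ : Function.Surjective β := by
    intro d
    by_cases hd : d ∈ Set.range τ
    · obtain ⟨⟨v, b⟩, rfl⟩ := hd
      refine ⟨(Sum.inl ⟨e.symm v.1, fun h => v.2 ?_⟩, b), ?_⟩
      · exact (e.apply_symm_apply v.1).symm.trans ((congrArg e h).trans he0)
      · simp [β]
    · refine ⟨(Sum.inr (ε.symm (q.symm ⟨d, hd⟩).1), (q.symm ⟨d, hd⟩).2), ?_⟩
      simp [β]
  -- Equal genus and equally many vertices force equally many edges, so surjectivity of `β` is
  -- enough.
  have hcard : Nat.card S.toGraph.D = Nat.card H.D := by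
    have h1 := S.hasGenus_toGraph.2
    have h2 := hH.2
    have h3 : S.toGraph.numVertices = H.numVertices := Nat.card_congr e
    rw [Graph.card_D, Graph.card_D]
    omega
  refine ⟨S, ⟨GenusGraph.isoOfEquiv e
    (Equiv.ofBijective β (hβ.bijective_of_nat_card_le hcard.le)) ?_ ?_⟩⟩
  · rintro ⟨v | m, b⟩
    · exact hτrev _ b
    · exact congrArg Subtype.val (hq (ε m) b)
  · rintro ⟨⟨v, hv⟩ | m, b⟩
    · cases b
      · exact (hδ ⟨e v, hene v hv⟩).1.symm
      · exact (hepar v hv).trans (dif_neg (hene v hv))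
    · exact hemark (m, b)

instance (g : ℕ) : (PlanarTree.graphFunctor g).EssSurj where
  mem_essImage G := by
    obtain ⟨S, ⟨i⟩⟩ := G.unop.exists_planarTree
    exact ⟨S, ⟨i.symm.op⟩⟩

theorem isQuasiGrobner_genusGraph_op (g : ℕ) : IsQuasiGrobner (GenusGraph g)ᵒᵖ :=
  ⟨PlanarTree g, inferInstance, PlanarTree.graphFunctor g, PlanarTree.isGrobner, inferInstance,
    PlanarTree.propertyF_graphFunctor⟩

end GraphContraction

theorem theorem1p1 (g : ℕ) :
    GraphContraction.IsQuasiGrobner (GraphContraction.GenusGraph g)ᵒᵖ ∧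
      ∀ (k : Type u) [CommRing k] [IsNoetherianRing k],
        GraphContraction.RepLocallyNoetherian.{1, 0, w, u} k (GraphContraction.GenusGraph g)ᵒᵖ := by
  have h := GraphContraction.isQuasiGrobner_genusGraph_op g
  exact ⟨h, fun k _ _ => h.repLocallyNoetherian⟩
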